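/- For $n\ge 1$ let $T_n=(a_{i-j,n})_{i,j=1}^n$ be a random Toeplitz matrix whose complex input variables $a_{j,n}=x_{j,n}+\mathrm{i}\,y_{j,n}$, $j\in\mathbb Z$, satisfy the following pair-correlation assumption: $\mathbf E[a_{j,n}]=0$ for all $j\in\mathbb Z$; for each $n$ the vectors $(x_{j,n},x_{-j,n},y_{j,n},y_{-j,n})$, $j=0,1,2,\dots$, are independent; and there are real constants $\sigma_x,\sigma_y,\rho_1,\dots,\rho_6$ and $c_k<\infty$, not depending on $n$ and $j$, such that for all $n\ge 1$ (i) $\mathbf E[x_{j,n}^2]=\sigma_x^2$ and $\mathbf E[y_{j,n}^2]=\sigma_y^2$ for all $j\ne 0$; (ii) $\mathbf E[x_{j,n}y_{j,n}]=\rho_1$, $\mathbf E[x_{j,n}x_{-j,n}]=\rho_2$, $\mathbf E[x_{j,n}y_{-j,n}]=\rho_3$, $\mathbf E[x_{-j,n}y_{j,n}]=\rho_4$, $\mathbf E[y_{j,n}y_{-j,n}]=\rho_5$, $\mathbf E[x_{-j,n}y_{-j,n}]=\rho_6$ for all $j\ge 1$; (iii) $\mathbf E|x_{j,n}|^k\le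 c_k$ and $\mathbf E|y_{j,n}|^k\le c_k$ for all $j\in\mathbb Z$ and $k\ge 1$. For each $n$ let $T_n^{(1)},\dots,T_n^{(m)}$ be independent copies of $T_n$ (the Toeplitz matrices built from $m$ independent copies of the input sequence). Let $D_n^{(i)}=(d^{(i)}_{k-l})_{k,l=1}^n$, $1\le i\le m$, be deterministic Toeplitz matrices with complex $d^{(i)}_k$ satisfying $\sum_{k\in\mathbb Z}|d^{(i)}_k|<\infty$, and let $P_n$ be the $n\times n$ backward identity matrix, $(P_n)_{kl}=1$ if $k+l=n+1$ and $0$ otherwise. Put $\varphi_n(B)=\frac1n\mathbf E[\operatorname{Tr}B]$. Then $\{P_n,\ n^{-1/2}T_n^{(i)},\ D_n^{(i)}:\ 1\le i\le m\}$ converge jointly in $*$-distribution: there are a $*$-probability space $(\mathcal A,\varphi)$ (a unital complex $*$-algebra with a linear functional $\varphi$ such that $\varphi(1)=1$ and $\varphi(aa^*)\ge 0$ for all $a$) and elements $p,t_1,\dots,t_m,\delta_1,\dots,\delta_m\in\mathcal A$ such that for every monomial $q$ in noncommuting variables and their adjoints, $\varphi_n$ of $q$ evaluated at these matrices and their conjugate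 transposes is well defined (the trace is integrable) and converges, as $n\to\infty$, to $\varphi(q(p,t_1,\dots,t_m,\delta_1,\dots,\delta_m))$. In particular, $\{P_n,n^{-1/2}T_n,D_n\}$ converge jointly. Moreover, for every monomial $q$ in $p,t_i,\delta_i$ and their adjoints, let $q_{P,D}$ be obtained from $q$ by deleting all letters $t_i,t_i^*$, and $q_{P,T}$ by deleting all letters $\delta_i,\delta_i^*$, keeping the order of the remaining letters. Then $\varphi(q)=\varphi(q_{P,D})\,\varphi(q_{P,T})$, and $\varphi(q)=0$ if the number of letters $p,p^*$ in $q$ is odd or the number of letters $t_i,t_i^*$ in $q$ is odd. -/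

import Mathlib

open MeasureTheory ProbabilityTheory Filter Topology

/-- A `*`-probability space: a unital complex `*`-algebra with a normalized positive linear
functional. -/
structure StarProbabilitySpace where
  carrier : Type
  [ring : Ring carrier]
  [starRing : StarRing carrier]
  [algebra : Algebra ℂ carrier]
  [starModule : StarModule ℂ carrier]
  φ : carrier →ₗ[ℂ] ℂ
  φ_one : φ 1 = 1
  φ_nonneg : ∀ a : carrier, 0 ≤ (φ (a * star a)).re ∧ (φ (a * star a)).im = 0

attribute [instance] StarProbabilitySpace.ring StarProbabilitySpace.starRing
  StarProbabilitySpace.algebra StarProbabilitySpace.starModule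

/-- The `*`-monomial `x_{i₁}^{ε₁} ⋯ x_{i_k}^{ε_k}`; the Boolean `true` stands for `ε = *`.
For complex matrices `star` is the conjugate transpose. -/
def starMonomial {ι A : Type*} [Monoid A] [Star A] (x : ι → A) (w : List (ι × Bool)) : A :=
  (w.map fun p => if p.2 then star (x p.1) else x p.1).prod

/-- The state `φ_n(B) = n⁻¹ E[Tr B]` on random `n × n` matrices. -/
noncomputable def matrixState {Ω : Type*} [MeasurableSpace Ω] (μ : Measure Ω) {n : ℕ}
    (B : Ω → Matrix (Fin n) (Fin n) ℂ) : ℂ :=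
  (n : ℂ)⁻¹ * ∫ ω, (B ω).trace ∂μ

/-- Joint convergence in `*`-distribution of the families `(A n i)_i` of random `n × n` matrices
to the elements `x i` of `S`: every `*`-moment exists for `n ≥ 1` and converges to the
corresponding `*`-moment of the limit. -/
def ConvergesInStarDistribution {ι : Type*} {Ω : ℕ → Type*} [∀ n, MeasurableSpace (Ω n)]
    (μ : ∀ n, Measure (Ω n)) (A : ∀ n, ι → Ω n → Matrix (Fin n) (Fin n) ℂ)
    (S : StarProbabilitySpace) (x : ι → S.carrier) : Prop :=
  ∀ w : List (ι × Bool),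
    (∀ n, 1 ≤ n → Integrable (fun ω => (starMonomial (fun i => A n i ω) w).trace) (μ n)) ∧
    Tendsto (fun n => matrixState (μ n) fun ω => starMonomial (fun i => A n i ω) w) atTop
      (𝓝 (S.φ (starMonomial x w)))

/-- The `n × n` Toeplitz matrix `(a_{i-j})`. -/
def toeplitz (n : ℕ) (a : ℤ → ℂ) : Matrix (Fin n) (Fin n) ℂ :=
  Matrix.of fun i j => a ((i : ℤ) - (j : ℤ))

/-- The `n × n` backward identity. -/
def backwardIdentity (n : ℕ) : Matrix (Fin n) (Fin n) ℂ :=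
  Matrix.of fun i j => if i = Fin.rev j then 1 else 0

/-- The pair-correlation assumption on a complex input sequence `a_j = x_j + i y_j`, with
moment bounds `c k`. The second-moment conditions are imposed for `j ≠ 0` only. -/
structure PairCorrelated {Ω : Type*} [MeasurableSpace Ω] (μ : Measure Ω)
    (σx σy ρ₁ ρ₂ ρ₃ ρ₄ ρ₅ ρ₆ : ℝ) (c : ℕ → ℝ) (a : ℤ → Ω → ℂ) : Prop where
  measurable : ∀ j, Measurable (a j)
  mean_zero : ∀ j, ∫ ω, a j ω ∂μ = 0
  /-- `(x_j, x_{-j}, y_j, y_{-j})`, `j = 0, 1, 2, …`, are independent; the quadruple is coded by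
  the pair `(a_j, a_{-j})`. -/
  indep : iIndepFun (fun (j : ℕ) ω => (a (j : ℤ) ω, a (-(j : ℤ)) ω)) μ
  var_x : ∀ j, j ≠ 0 → ∫ ω, (a j ω).re ^ 2 ∂μ = σx ^ 2
  var_y : ∀ j, j ≠ 0 → ∫ ω, (a j ω).im ^ 2 ∂μ = σy ^ 2
  corr₁ : ∀ j, 0 < j → ∫ ω, (a j ω).re * (a j ω).im ∂μ = ρ₁
  corr₂ : ∀ j, 0 < j → ∫ ω, (a j ω).re * (a (-j) ω).re ∂μ = ρ₂
  corr₃ : ∀ j, 0 < j → ∫ ω, (a j ω).re * (a (-j) ω).im ∂μ = ρ₃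
  corr₄ : ∀ j, 0 < j → ∫ ω, (a (-j) ω).re * (a j ω).im ∂μ = ρ₄
  corr₅ : ∀ j, 0 < j → ∫ ω, (a j ω).im * (a (-j) ω).im ∂μ = ρ₅
  corr₆ : ∀ j, 0 < j → ∫ ω, (a (-j) ω).re * (a (-j) ω).im ∂μ = ρ₆
  moment_x : ∀ j k, 1 ≤ k → Integrable (fun ω => |(a j ω).re| ^ k) μ ∧
    ∫ ω, |(a j ω).re| ^ k ∂μ ≤ c k
  moment_y : ∀ j k, 1 ≤ k → Integrable (fun ω => |(a j ω).im| ^ k) μ ∧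
    ∫ ω, |(a j ω).im| ^ k ∂μ ≤ c k

/-- Names of the matrices: `P` for the backward identity, `T i` and `D i` for the random and the
deterministic Toeplitz matrices. -/
inductive Letter (m : ℕ) where
  | P : Letter m
  | T : Fin m → Letter m
  | D : Fin m → Letter m

/-- Is the letter `P`? -/
def Letter.isP {m : ℕ} : Letter m → Bool
  | .P => true
  | .T _ => false
  | .D _ => false

/-- Is the letter some `T i`? -/
def Letter.isT {m : ℕ} : Letter m → Bool
  | .P => false
  | .T _ => true
  | .D _ => false

/-- Is the letter some `D i`? -/
def Letter.isD {m : ℕ} : Letter m → Bool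
  | .P => false
  | .T _ => false
  | .D _ => true

/-- The matrices `P_n`, `n^{-1/2} T_n^{(i)}`, `D_n^{(i)}`, where `T_n^{(i)}` has input sequence
`a i` and `D_n^{(i)}` has input sequence `d i`. -/
noncomputable def modelMatrix {m : ℕ} {Ω : Type*} (n : ℕ) (a : Fin m → ℤ → Ω → ℂ)
    (d : Fin m → ℤ → ℂ) : Letter m → Ω → Matrix (Fin n) (Fin n) ℂ
  | .P, _ => backwardIdentity n
  | .T i, ω => (((Real.sqrt n)⁻¹ : ℝ) : ℂ) • toeplitz n (fun j => a i j ω)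
  | .D i, _ => toeplitz n (d i)

/-!
Write each Toeplitz matrix as a sum of shifts and move all backward identities to the right end of
the word; passing a Toeplitz matrix reflects its input sequence. The trace becomes a sum over closed
lattice paths in `{0, …, n - 1}` whose steps are the indices of the entries.

The coincidences among the absolute values of the random indices split the sum. By independence and
centering every class that occurs has at least two members, and after the scaling by `n ^ (-1/2)`
per random matrix only pairings survive. For a pairing the path sum is a Riemann sum, so it
converges to the volume of a set of continuous paths. The deterministic entries are summable, so
their steps are `o(n)` and invisible to this volume: they only enter through the condition that they
sum to `0`, which gives the constant term of a product of Laurent series. Hence the limit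
factorizes. An odd number of backward identities turns the closing condition into an equation for
the starting point, which costs a factor `n`, so the limit is `0`.

The limit state lives on the algebra of noncommutative `*`-polynomials, where its positivity is
inherited from the states `φ_n`.
-/

/-! ### Second moments of a pair-correlated sequence -/

theorem iIndepFun_of_identDistrib {ι Ω Ω' : Type*} {E : ι → Type*} [MeasurableSpace Ω]
    [MeasurableSpace Ω'] [∀ i, MeasurableSpace (E i)] {μ : Measure Ω} {μ' : Measure Ω'}
    [IsProbabilityMeasure μ] [IsProbabilityMeasure μ'] {X : ∀ i, Ω → E i} {X' : ∀ i, Ω' → E i}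
    (hX : ∀ i, Measurable (X i)) (hX' : ∀ i, Measurable (X' i)) (h : iIndepFun X μ)
    (hid : IdentDistrib (fun ω i => X' i ω) (fun ω i => X i ω) μ' μ) : iIndepFun X' μ' := by
  have marginal : ∀ i, μ'.map (X' i) = μ.map (X i) := fun i =>
    (hid.comp (u := fun f : ∀ i, E i => f i) (by fun_prop)).map_eq
  rw [iIndepFun_iff_map_fun_eq_infinitePi_map (by fun_prop)] at h ⊢
  rw [hid.map_eq, h]
  simp only [marginal]

theorem PairCorrelated.of_identDistrib {Ω Ω' : Type*} [MeasurableSpace Ω] [MeasurableSpace Ω']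
    {μ : Measure Ω} {μ' : Measure Ω'} [IsProbabilityMeasure μ] [IsProbabilityMeasure μ']
    {σx σy ρ₁ ρ₂ ρ₃ ρ₄ ρ₅ ρ₆ : ℝ} {c : ℕ → ℝ} {a : ℤ → Ω → ℂ} {a' : ℤ → Ω' → ℂ}
    (h : PairCorrelated μ σx σy ρ₁ ρ₂ ρ₃ ρ₄ ρ₅ ρ₆ c a) (hm : ∀ j, Measurable (a' j))
    (hid : IdentDistrib (fun ω j => a' j ω) (fun ω j => a j ω) μ' μ) :
    PairCorrelated μ' σx σy ρ₁ ρ₂ ρ₃ ρ₄ ρ₅ ρ₆ c a' := by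
  have expect : ∀ F : (ℤ → ℂ) → ℝ, Measurable F →
      ∫ ω, F (fun j => a' j ω) ∂μ' = ∫ ω, F (fun j => a j ω) ∂μ :=
    fun F hF => (hid.comp hF).integral_eq
  have integrable : ∀ F : (ℤ → ℂ) → ℝ, Measurable F → Integrable (fun ω => F fun j => a j ω) μ →
      Integrable (fun ω => F fun j => a' j ω) μ' :=
    fun F hF hi => (hid.comp hF).integrable_iff.2 hi
  exact
    { measurable := hm
      mean_zero := fun j => ((hid.comp (u := fun f : ℤ → ℂ => f j)
        (by fun_prop)).integral_eq).trans (h.mean_zero j)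
      indep := iIndepFun_of_identDistrib
        (fun j => (h.measurable _).prodMk (h.measurable _)) (fun j => (hm _).prodMk (hm _)) h.indep
        (hid.comp (u := fun (f : ℤ → ℂ) (j : ℕ) => (f j, f (-j))) (by fun_prop))
      var_x := fun j hj => (expect (fun f => (f j).re ^ 2) (by fun_prop)).trans (h.var_x j hj)
      var_y := fun j hj => (expect (fun f => (f j).im ^ 2) (by fun_prop)).trans (h.var_y j hj)
      corr₁ := fun j hj =>
        (expect (fun f => (f j).re * (f j).im) (by fun_prop)).trans (h.corr₁ j hj)
      corr₂ := fun j hj =>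
        (expect (fun f => (f j).re * (f (-j)).re) (by fun_prop)).trans (h.corr₂ j hj)
      corr₃ := fun j hj =>
        (expect (fun f => (f j).re * (f (-j)).im) (by fun_prop)).trans (h.corr₃ j hj)
      corr₄ := fun j hj =>
        (expect (fun f => (f (-j)).re * (f j).im) (by fun_prop)).trans (h.corr₄ j hj)
      corr₅ := fun j hj =>
        (expect (fun f => (f j).im * (f (-j)).im) (by fun_prop)).trans (h.corr₅ j hj)
      corr₆ := fun j hj =>
        (expect (fun f => (f (-j)).re * (f (-j)).im) (by fun_prop)).trans (h.corr₆ j hj)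
      moment_x := fun j k hk =>
        ⟨integrable (fun f => |(f j).re| ^ k) (by fun_prop) (h.moment_x j k hk).1,
          (expect (fun f => |(f j).re| ^ k) (by fun_prop)).trans_le (h.moment_x j k hk).2⟩
      moment_y := fun j k hk =>
        ⟨integrable (fun f => |(f j).im| ^ k) (by fun_prop) (h.moment_y j k hk).1,
          (expect (fun f => |(f j).im| ^ k) (by fun_prop)).trans_le (h.moment_y j k hk).2⟩ }

/-- Complex conjugation of `z`, performed if `b` holds. -/
noncomputable def conjIf (b : Bool) (z : ℂ) : ℂ := if b then star z else z

/-- The integer `k`, negated if `b` holds. -/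
def negIf (b : Bool) (k : ℤ) : ℤ := if b then -k else k

@[simp]
theorem natAbs_negIf (b : Bool) (k : ℤ) : (negIf b k).natAbs = k.natAbs := by
  cases b <;> simp [negIf]

@[simp]
theorem negIf_mul_negIf (b : Bool) (j k : ℤ) : negIf b j * negIf b k = j * k := by
  cases b <;> simp [negIf]

theorem exists_negIf_abs_of_mul_pos {j k : ℤ} (h : 0 < j * k) :
    ∃ s, j = negIf s |j| ∧ k = negIf s |k| := by
  rcases pos_and_pos_or_neg_and_neg_of_mul_pos h with ⟨hj, hk⟩ | ⟨hj, hk⟩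
  · exact ⟨false, (abs_of_pos hj).symm, (abs_of_pos hk).symm⟩
  · exact ⟨true, by simp [negIf, abs_of_neg hj], by simp [negIf, abs_of_neg hk]⟩

@[simp]
theorem norm_conjIf (b : Bool) (z : ℂ) : ‖conjIf b z‖ = ‖z‖ := by
  cases b <;> simp [conjIf]

@[fun_prop]
theorem measurable_conjIf (b : Bool) : Measurable (conjIf b) := by
  cases b
  · exact measurable_id
  · exact continuous_star.measurable

theorem integral_conjIf {Ω : Type*} [MeasurableSpace Ω] {μ : Measure Ω} (b : Bool) (f : Ω → ℂ) :
    ∫ ω, conjIf b (f ω) ∂μ = conjIf b (∫ ω, f ω ∂μ) := by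
  cases b
  · rfl
  · exact integral_conj

/-- The real part (`e = false`) or the imaginary part (`e = true`) of a complex number. -/
def reOrIm (e : Bool) (z : ℂ) : ℝ := if e then z.im else z.re

theorem conjIf_mul_conjIf (b b' : Bool) (z z' : ℂ) :
    conjIf b z * conjIf b' z' =
      ∑ e, ∑ e', (if e then conjIf b Complex.I else 1) * (if e' then conjIf b' Complex.I else 1) *
        ((reOrIm e z * reOrIm e' z' : ℝ) : ℂ) := by
  cases b <;> cases b' <;> apply Complex.ext <;> simp [conjIf, reOrIm] <;> ring

namespace PairCorrelated

variable {Ω Ω' : Type*} [MeasurableSpace Ω] [MeasurableSpace Ω'] {μ : Measure Ω}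
  {μ' : Measure Ω'} {σx σy ρ₁ ρ₂ ρ₃ ρ₄ ρ₅ ρ₆ : ℝ} {c : ℕ → ℝ} {a : ℤ → Ω → ℂ} {a' : ℤ → Ω' → ℂ}

theorem integrable_reOrIm_mul (h : PairCorrelated μ σx σy ρ₁ ρ₂ ρ₃ ρ₄ ρ₅ ρ₆ c a)
    (e e' : Bool) (j j' : ℤ) :
    Integrable (fun ω => reOrIm e (a j ω) * reOrIm e' (a j' ω)) μ := by
  have square_integrable : ∀ (e : Bool) (j : ℤ), MemLp (fun ω => reOrIm e (a j ω)) 2 μ := by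
    intro e j
    have hm := h.measurable j
    cases e
    · exact (memLp_two_iff_integrable_sq (f := fun ω => (a j ω).re) (by fun_prop)).2
        (by simpa using (h.moment_x j 2 one_le_two).1)
    · exact (memLp_two_iff_integrable_sq (f := fun ω => (a j ω).im) (by fun_prop)).2
        (by simpa using (h.moment_y j 2 one_le_two).1)
  exact (square_integrable e j).integrable_mul (square_integrable e' j')

theorem integral_reOrIm_mul_congr (h : PairCorrelated μ σx σy ρ₁ ρ₂ ρ₃ ρ₄ ρ₅ ρ₆ c a)
    (h' : PairCorrelated μ' σx σy ρ₁ ρ₂ ρ₃ ρ₄ ρ₅ ρ₆ c a') (e e' s s' : Bool) {N N' : ℤ}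
    (hN : 0 < N) (hN' : 0 < N') :
    ∫ ω, reOrIm e (a (negIf s N) ω) * reOrIm e' (a (negIf s' N) ω) ∂μ =
      ∫ ω, reOrIm e (a' (negIf s N') ω) * reOrIm e' (a' (negIf s' N') ω) ∂μ' := by
  have vx := fun j hj => (h.var_x j hj).trans (h'.var_x N' hN'.ne').symm
  have vx' := fun j hj => (h.var_x j hj).trans (h'.var_x (-N') (by lia)).symm
  have vy := fun j hj => (h.var_y j hj).trans (h'.var_y N' hN'.ne').symm
  have vy' := fun j hj => (h.var_y j hj).trans (h'.var_y (-N') (by lia)).symm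
  have r₁ := (h.corr₁ N hN).trans (h'.corr₁ N' hN').symm
  have r₂ := (h.corr₂ N hN).trans (h'.corr₂ N' hN').symm
  have r₃ := (h.corr₃ N hN).trans (h'.corr₃ N' hN').symm
  have r₄ := (h.corr₄ N hN).trans (h'.corr₄ N' hN').symm
  have r₅ := (h.corr₅ N hN).trans (h'.corr₅ N' hN').symm
  have r₆ := (h.corr₆ N hN).trans (h'.corr₆ N' hN').symm
  specialize vx N hN.ne'
  specialize vx' (-N) (by lia)
  specialize vy N hN.ne'
  specialize vy' (-N) (by lia)
  simp only [pow_two] at vx vx' vy vy'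
  -- Up to exchanging the two factors, the sixteen cases are the second moments of the definition.
  cases e <;> cases e' <;> cases s <;> cases s' <;>
    simp only [reOrIm, negIf, if_true, if_false, Bool.false_eq_true] <;>
    first
    | assumption
    | (simp only [mul_comm] at *; assumption)

theorem integral_conjIf_mul (h : PairCorrelated μ σx σy ρ₁ ρ₂ ρ₃ ρ₄ ρ₅ ρ₆ c a) (b b' : Bool)
    (j j' : ℤ) :
    ∫ ω, conjIf b (a j ω) * conjIf b' (a j' ω) ∂μ =
      ∑ e, ∑ e', (if e then conjIf b Complex.I else 1) * (if e' then conjIf b' Complex.I else 1) *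
        ((∫ ω, reOrIm e (a j ω) * reOrIm e' (a j' ω) ∂μ : ℝ) : ℂ) := by
  have term_integrable : ∀ e e' (z : ℂ), Integrable
      (fun ω => z * ((reOrIm e (a j ω) * reOrIm e' (a j' ω) : ℝ) : ℂ)) μ :=
    fun e e' z => (h.integrable_reOrIm_mul e e' j j').ofReal.const_mul z
  simp only [conjIf_mul_conjIf]
  rw [integral_finsetSum _ fun e _ => integrable_finsetSum _ fun e' _ => term_integrable e e' _]
  refine Finset.sum_congr rfl fun e _ => ?_
  rw [integral_finsetSum _ fun e' _ => term_integrable e e' _]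
  simp only [integral_const_mul, integral_complex_ofReal]

theorem integral_conjIf_mul_congr (h : PairCorrelated μ σx σy ρ₁ ρ₂ ρ₃ ρ₄ ρ₅ ρ₆ c a)
    (h' : PairCorrelated μ' σx σy ρ₁ ρ₂ ρ₃ ρ₄ ρ₅ ρ₆ c a') (b b' : Bool) {j j' k k' : ℤ}
    (hj : j.natAbs = j'.natAbs) (hk : k.natAbs = k'.natAbs) (hjk : 0 < j * k)
    (hjk' : 0 < j' * k') :
    ∫ ω, conjIf b (a j ω) * conjIf b' (a j' ω) ∂μ =
      ∫ ω, conjIf b (a' k ω) * conjIf b' (a' k' ω) ∂μ' := by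
  rw [h.integral_conjIf_mul, h'.integral_conjIf_mul]
  obtain ⟨s, hs, hs'⟩ := exists_negIf_abs_of_mul_pos hjk
  obtain ⟨t, ht, ht'⟩ := exists_negIf_abs_of_mul_pos hjk'
  rw [hs, hs', ht, ht', Int.abs_eq_natAbs j', ← hj, ← Int.abs_eq_natAbs, Int.abs_eq_natAbs k',
    ← hk, ← Int.abs_eq_natAbs]
  have hj0 : 0 < |j| := abs_pos.2 (left_ne_zero_of_mul hjk.ne')
  have hk0 : 0 < |k| := abs_pos.2 (right_ne_zero_of_mul hjk.ne')
  simp only [h.integral_reOrIm_mul_congr h' _ _ s t hj0 hk0]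

theorem integrable_norm_pow (h : PairCorrelated μ σx σy ρ₁ ρ₂ ρ₃ ρ₄ ρ₅ ρ₆ c a) {k : ℕ}
    (hk : 1 ≤ k) (j : ℤ) : Integrable (fun ω => ‖a j ω‖ ^ k) μ := by
  have hm := h.measurable j
  refine ((((h.moment_x j k hk).1.add (h.moment_y j k hk).1).const_mul (2 ^ (k - 1)))).mono'
    (by fun_prop) (Eventually.of_forall fun ω => ?_)
  rw [Real.norm_of_nonneg (by positivity)]
  exact (pow_le_pow_left₀ (norm_nonneg _) (Complex.norm_le_abs_re_add_abs_im _) k).trans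
    (add_pow_le (abs_nonneg _) (abs_nonneg _) k)

theorem integral_norm_pow_le (h : PairCorrelated μ σx σy ρ₁ ρ₂ ρ₃ ρ₄ ρ₅ ρ₆ c a) {k : ℕ}
    (hk : 1 ≤ k) (j : ℤ) : ∫ ω, ‖a j ω‖ ^ k ∂μ ≤ 2 ^ k * c k := by
  have hx := h.moment_x j k hk
  have hy := h.moment_y j k hk
  calc ∫ ω, ‖a j ω‖ ^ k ∂μ
      ≤ ∫ ω, 2 ^ (k - 1) * (|(a j ω).re| ^ k + |(a j ω).im| ^ k) ∂μ :=
        integral_mono (h.integrable_norm_pow hk j) ((hx.1.add hy.1).const_mul _) fun ω =>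
          (pow_le_pow_left₀ (norm_nonneg _) (Complex.norm_le_abs_re_add_abs_im _) k).trans
            (add_pow_le (abs_nonneg _) (abs_nonneg _) k)
    _ = 2 ^ (k - 1) * (∫ ω, |(a j ω).re| ^ k ∂μ + ∫ ω, |(a j ω).im| ^ k ∂μ) := by
        rw [integral_const_mul, integral_add hx.1 hy.1]
    _ ≤ 2 ^ (k - 1) * (c k + c k) := by gcongr; exacts [hx.2, hy.2]
    _ = 2 ^ k * c k := by rw [← two_mul, ← mul_assoc, ← pow_succ, Nat.sub_add_cancel hk]

end PairCorrelated

/-! ### Mixed moments of the entries -/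

theorem prod_le_one_add_sum_pow_card {ι : Type*} [Fintype ι] {f : ι → ℝ} (hf : ∀ i, 0 ≤ f i) :
    ∏ i, f i ≤ 1 + ∑ i, f i ^ Fintype.card ι := by
  rcases isEmpty_or_nonempty ι with hι | hι
  · simp
  obtain ⟨i, -, hmax⟩ := Finset.univ.exists_max_image f Finset.univ_nonempty
  calc ∏ j, f j ≤ ∏ _j, f i := Finset.prod_le_prod (fun j _ => hf j) hmax
    _ = f i ^ Fintype.card ι := by simp
    _ ≤ ∑ j, f j ^ Fintype.card ι := Finset.single_le_sum (f := fun j => f j ^ Fintype.card ι)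
      (fun j _ => pow_nonneg (hf j) _) (Finset.mem_univ i)
    _ ≤ 1 + ∑ j, f j ^ Fintype.card ι := le_add_of_nonneg_left zero_le_one

open scoped Classical in
theorem integral_prod_comp_eq_prod_quotient {κ Ω E T : Type*} [MeasurableSpace Ω]
    [MeasurableSpace E] [Fintype T] {μ : Measure Ω} {X : κ → Ω → E} (hX : iIndepFun X μ)
    (hXm : ∀ j, Measurable (X j)) {F : T → E → ℂ} (hF : ∀ s, Measurable (F s)) {key : T → κ}
    {S : Setoid T} (hS : S = Setoid.ker key) :
    ∫ ω, ∏ s, F s (X (key s) ω) ∂μ =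
      ∏ q : Quotient S, ∫ ω, ∏ s with Quotient.mk S s = q, F s (X (key s) ω) ∂μ := by
  subst hS
  have block_prod : ∀ (q : Quotient (Setoid.ker key)) ω,
      ∏ s with Quotient.mk _ s = q, F s (X (key s) ω) =
        ∏ s with Quotient.mk _ s = q, F s (X (Setoid.kerLift key q) ω) := fun q ω =>
    Finset.prod_congr rfl fun s hs => by rw [← (Finset.mem_filter.1 hs).2]; rfl
  have indep := hX.precomp (Setoid.kerLift_injective key)
  simp only [block_prod]
  rw [← indep.integral_fun_prod_comp
    (f := fun q z => ∏ s with Quotient.mk (Setoid.ker key) s = q, F s z)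
    (fun q => (hXm _).aemeasurable) fun q =>
      (Finset.measurable_fun_prod _ fun s _ => hF s).aestronglyMeasurable]
  simp only [← block_prod, Finset.prod_fiberwise]

/-- The sequence `g`, reflected about the origin if `t.1` holds, with values conjugated if `t.2`
holds. Flipping `P T(g) P` and taking `T(g)^*` act on the sequence of a Toeplitz matrix in this
way. -/
noncomputable def twist (t : Bool × Bool) (g : ℤ → ℂ) (k : ℤ) : ℂ := conjIf t.2 (g (negIf t.1 k))

/-- The entry of index `k` of the copy number `t.1` of the input sequence, after the twist
`t.2`. -/
noncomputable def inputEntry {I Ω : Type*} (a : I → ℤ → Ω → ℂ) (t : I × Bool × Bool) (k : ℤ)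
    (ω : Ω) : ℂ :=
  twist t.2 (fun j => a t.1 j ω) k

/-- The mixed moment `E ∏ₛ a_{k_s}` of entries with labels `τ s` and indices `k s`. -/
noncomputable def mixedMoment {I Ω T : Type*} [Fintype T] [MeasurableSpace Ω]
    (μ : Measure Ω) (a : I → ℤ → Ω → ℂ) (τ : T → I × Bool × Bool) (k : T → ℤ) : ℂ :=
  ∫ ω, ∏ s, inputEntry a (τ s) (k s) ω ∂μ

/-- The independent block containing the entry `s`: the block `(i, N)` is the pair
`(a_N, a_{-N})` of the copy number `i`. -/
def blockIndex {I T : Type*} (i : T → I) (k : T → ℤ) (s : T) : I × ℕ := (i s, (k s).natAbs)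

/-- Every class has exactly two elements. -/
def IsPairing {T : Type*} (S : Setoid T) : Prop := ∀ s, {s' | S s' s}.ncard = 2

section MixedMoment

variable {I Ω Ω' T : Type*} [Fintype T] [MeasurableSpace Ω] [MeasurableSpace Ω']
  {μ : Measure Ω} {μ' : Measure Ω'} {σx σy ρ₁ ρ₂ ρ₃ ρ₄ ρ₅ ρ₆ : I → ℝ} {c : I → ℕ → ℝ}
  {a : I → ℤ → Ω → ℂ} {a' : I → ℤ → Ω' → ℂ}

variable
  (h : ∀ i, PairCorrelated μ (σx i) (σy i) (ρ₁ i) (ρ₂ i) (ρ₃ i) (ρ₄ i) (ρ₅ i) (ρ₆ i) (c i) (a i))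

include h

theorem measurable_inputEntry (t : I × Bool × Bool) (k : ℤ) : Measurable (inputEntry a t k) :=
  (measurable_conjIf _).comp ((h _).measurable _)

theorem integrable_norm_inputEntry_pow (t : I × Bool × Bool) (k : ℤ) {N : ℕ} (hN : 1 ≤ N) :
    Integrable (fun ω => ‖inputEntry a t k ω‖ ^ N) μ := by
  simpa only [inputEntry, twist, norm_conjIf] using (h t.1).integrable_norm_pow hN _

theorem integrable_one_add_sum_norm_inputEntry_pow [IsProbabilityMeasure μ]
    (τ : T → I × Bool × Bool) (k : T → ℤ) :
    Integrable (fun ω => 1 + ∑ s, ‖inputEntry a (τ s) (k s) ω‖ ^ Fintype.card T) μ :=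
  (integrable_const 1).add <| integrable_finsetSum _ fun s _ =>
    integrable_norm_inputEntry_pow h _ _ (Fintype.card_pos_iff.2 ⟨s⟩)

theorem integrable_prod_inputEntry [IsProbabilityMeasure μ]
    (τ : T → I × Bool × Bool) (k : T → ℤ) :
    Integrable (fun ω => ∏ s, inputEntry a (τ s) (k s) ω) μ :=
  (integrable_one_add_sum_norm_inputEntry_pow h τ k).mono'
    (Finset.measurable_fun_prod _ fun _ _ => measurable_inputEntry h _ _).aestronglyMeasurable
    (Eventually.of_forall fun ω => by
      rw [norm_prod]
      exact prod_le_one_add_sum_pow_card fun _ => norm_nonneg _)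

theorem norm_mixedMoment_le [IsProbabilityMeasure μ]
    (τ : T → I × Bool × Bool) (k : T → ℤ) :
    ‖mixedMoment μ a τ k‖ ≤ 1 + ∑ s, 2 ^ Fintype.card T * c (τ s).1 (Fintype.card T) := by
  have card_pos : ∀ _ : T, 1 ≤ Fintype.card T := fun s => Fintype.card_pos_iff.2 ⟨s⟩
  calc ‖mixedMoment μ a τ k‖
      ≤ ∫ ω, (1 + ∑ s, ‖inputEntry a (τ s) (k s) ω‖ ^ Fintype.card T) ∂μ :=
        norm_integral_le_of_norm_le (integrable_one_add_sum_norm_inputEntry_pow h τ k)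
          (Eventually.of_forall fun ω => by
            rw [norm_prod]
            exact prod_le_one_add_sum_pow_card fun _ => norm_nonneg _)
    _ = 1 + ∑ s, ∫ ω, ‖inputEntry a (τ s) (k s) ω‖ ^ Fintype.card T ∂μ := by
        have hi := fun s => integrable_norm_inputEntry_pow h (τ s) (k s) (card_pos s)
        rw [integral_add (integrable_const 1) (integrable_finsetSum _ fun s _ => hi s),
          integral_finsetSum _ fun s _ => hi s]
        simp
    _ ≤ 1 + ∑ s, 2 ^ Fintype.card T * c (τ s).1 (Fintype.card T) := by
        gcongr with s
        simpa only [inputEntry, twist, norm_conjIf] using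
          (h (τ s).1).integral_norm_pow_le (card_pos s) _

variable (hind : iIndepFun (fun i ω j => a i j ω) μ)

include hind

theorem iIndepFun_blocks :
    iIndepFun (fun (p : I × ℕ) ω => (a p.1 (p.2 : ℤ) ω, a p.1 (-(p.2 : ℤ)) ω)) μ := by
  have hm := fun i => (h i).measurable
  refine iIndepFun_uncurry' (X := fun i (j : ℕ) ω => (a i (j : ℤ) ω, a i (-(j : ℤ)) ω))
    (fun i j => by fun_prop) ?_ fun i => (h i).indep
  exact hind.comp (fun _ (f : ℤ → ℂ) (j : ℕ) => (f (j : ℤ), f (-(j : ℤ)))) fun _ => by fun_prop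

open scoped Classical in
theorem mixedMoment_eq_prod {τ : T → I × Bool × Bool} {k : T → ℤ}
    {S : Setoid T} (hS : S = Setoid.ker (blockIndex (fun s => (τ s).1) k)) :
    mixedMoment μ a τ k = ∏ q : Quotient S,
      ∫ ω, ∏ s with Quotient.mk S s = q, inputEntry a (τ s) (k s) ω ∂μ := by
  have hm := fun i => (h i).measurable
  have entry_eq : ∀ s ω, inputEntry a (τ s) (k s) ω =
      conjIf (τ s).2.2 (if 0 ≤ negIf (τ s).2.1 (k s) then a (τ s).1 ((k s).natAbs : ℤ) ω
        else a (τ s).1 (-((k s).natAbs : ℤ)) ω) := by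
    intro s ω
    have hn := natAbs_negIf (τ s).2.1 (k s)
    rw [inputEntry, twist]
    split_ifs with hp
    · rw [show ((k s).natAbs : ℤ) = negIf (τ s).2.1 (k s) by lia]
    · rw [show -((k s).natAbs : ℤ) = negIf (τ s).2.1 (k s) by lia]
  have select_measurable : ∀ s, Measurable fun z : ℂ × ℂ =>
      conjIf (τ s).2.2 (if 0 ≤ negIf (τ s).2.1 (k s) then z.1 else z.2) := fun s =>
    (measurable_conjIf _).comp (by split_ifs <;> fun_prop)
  simp only [mixedMoment, entry_eq]
  exact integral_prod_comp_eq_prod_quotient (iIndepFun_blocks h hind) (by fun_prop)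
    select_measurable hS

theorem mixedMoment_eq_zero {τ : T → I × Bool × Bool} {k : T → ℤ} {s : T}
    (hs : ∀ s', blockIndex (fun s => (τ s).1) k s' = blockIndex (fun s => (τ s).1) k s → s' = s) :
    mixedMoment μ a τ k = 0 := by
  classical
  rw [mixedMoment_eq_prod h hind rfl]
  refine Finset.prod_eq_zero (Finset.mem_univ (Quotient.mk _ s)) ?_
  have singleton_block : (Finset.univ.filter fun s' =>
      Quotient.mk (Setoid.ker (blockIndex (fun s => (τ s).1) k)) s' = Quotient.mk _ s) = {s} := by
    ext s'
    simp only [Finset.mem_filter_univ, Finset.mem_singleton, Quotient.eq, Setoid.ker_def]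
    exact ⟨hs s', fun e => e ▸ rfl⟩
  rw [singleton_block]
  simp only [Finset.prod_singleton, inputEntry, twist, integral_conjIf, (h _).mean_zero]
  simp [conjIf]

theorem mixedMoment_congr (h' : ∀ i,
      PairCorrelated μ' (σx i) (σy i) (ρ₁ i) (ρ₂ i) (ρ₃ i) (ρ₄ i) (ρ₅ i) (ρ₆ i) (c i) (a' i))
    (hind' : iIndepFun (fun i ω j => a' i j ω) μ') {τ : T → I × Bool × Bool} {k k' : T → ℤ}
    {S : Setoid T} (hS : IsPairing S) (hk : S = Setoid.ker (blockIndex (fun s => (τ s).1) k))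
    (hk' : S = Setoid.ker (blockIndex (fun s => (τ s).1) k')) (hsign : ∀ s, 0 < k s * k' s) :
    mixedMoment μ a τ k = mixedMoment μ' a' τ k' := by
  classical
  rw [mixedMoment_eq_prod h hind hk, mixedMoment_eq_prod h' hind' hk']
  refine Finset.prod_congr rfl fun q _ => ?_
  obtain ⟨s₀, rfl⟩ := Quotient.exists_rep q
  obtain ⟨s, s', hne, hpair⟩ := Set.ncard_eq_two.1 (hS s₀)
  have block_eq : (Finset.univ.filter fun t => Quotient.mk S t = Quotient.mk S s₀) = {s, s'} := by
    ext t
    simpa [Quotient.eq] using Set.ext_iff.1 hpair t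
  have hrel : S s s' := S.trans (Set.ext_iff.1 hpair s |>.2 (by simp))
    (S.symm (Set.ext_iff.1 hpair s' |>.2 (by simp)))
  obtain ⟨same_copy, same_abs⟩ := Prod.ext_iff.1 (Setoid.ker_def.1 (hk ▸ hrel))
  have same_abs' := (Prod.ext_iff.1 (Setoid.ker_def.1 (hk' ▸ hrel))).2
  simp only [blockIndex] at same_copy same_abs same_abs'
  simp only [block_eq, Finset.prod_pair hne, inputEntry, twist, ← same_copy]
  exact (h _).integral_conjIf_mul_congr (h' _) _ _ (by simpa using same_abs)
    (by simpa using same_abs') (by simpa using hsign s) (by simpa using hsign s')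

end MixedMoment

/-! ### Riemann sums on the unit cube -/

theorem ae_linearMap_ne {ι : Type*} [Fintype ι] {L : (ι → ℝ) →ₗ[ℝ] ℝ} (hL : L ≠ 0) (c : ℝ) :
    ∀ᵐ x : ι → ℝ, L x ≠ c := by
  rw [ae_iff]
  simp only [not_not]
  by_cases hx : ∃ x₀, L x₀ = c
  · obtain ⟨x₀, rfl⟩ := hx
    have level_set : {x | L x = L x₀} = (fun x => -x₀ + x) ⁻¹' (LinearMap.ker L : Set (ι → ℝ)) := by
      ext x
      simp [neg_add_eq_zero, eq_comm (b := L x₀)]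
    rw [level_set, measure_preimage_add]
    exact Measure.addHaar_submodule _ _ fun htop => hL (LinearMap.ker_eq_top.1 htop)
  · rw [not_exists] at hx
    simp [hx]

section RiemannSum

variable {ι : Type*}

/-- The half-open unit cube. -/
def unitCube (ι : Type*) : Set (ι → ℝ) := Set.univ.pi fun _ => Set.Ico 0 1

/-- The half-open cube of side `1 / n` with corner `z / n`. -/
def gridCell (n : ℕ) (z : ι → ℕ) : Set (ι → ℝ) :=
  Set.univ.pi fun i => Set.Ico ((z i : ℝ) / n) ((z i + 1 : ℝ) / n)

theorem mem_gridCell_iff {n : ℕ} (hn : 1 ≤ n) {z : ι → ℕ} {x : ι → ℝ} :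
    x ∈ gridCell n z ↔ (∀ i, 0 ≤ x i) ∧ (fun i => ⌊n * x i⌋₊) = z := by
  have hn' : (0 : ℝ) < n := by exact_mod_cast hn
  simp only [gridCell, Set.mem_univ_pi, Set.mem_Ico, funext_iff, ← forall_and]
  refine forall_congr' fun i => ?_
  rw [div_le_iff₀ hn', lt_div_iff₀ hn', mul_comm (x i)]
  constructor
  · rintro ⟨h₁, h₂⟩
    have h0 : 0 ≤ (n : ℝ) * x i := le_trans (Nat.cast_nonneg _) h₁
    exact ⟨nonneg_of_mul_nonneg_right h0 hn', (Nat.floor_eq_iff h0).2 ⟨h₁, h₂⟩⟩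
  · rintro ⟨h₁, h₂⟩
    exact (Nat.floor_eq_iff (by positivity)).1 h₂

theorem measurableSet_unitCube [Countable ι] : MeasurableSet (unitCube ι) :=
  MeasurableSet.univ_pi fun _ => measurableSet_Ico

theorem measurableSet_gridCell [Countable ι] (n : ℕ) (z : ι → ℕ) : MeasurableSet (gridCell n z) :=
  MeasurableSet.univ_pi fun _ => measurableSet_Ico

variable [Fintype ι]

theorem volume_unitCube : volume (unitCube ι) = 1 := by
  simp [unitCube, Real.volume_pi_Ico]

theorem volume_gridCell_ne_top (n : ℕ) (z : ι → ℕ) : volume (gridCell n z) ≠ ⊤ := by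
  rw [gridCell, Real.volume_pi_Ico]
  exact ENNReal.prod_ne_top fun i _ => ENNReal.ofReal_ne_top

theorem volume_real_gridCell (n : ℕ) (z : ι → ℕ) :
    volume.real (gridCell n z) = ((n : ℝ) ^ Fintype.card ι)⁻¹ := by
  have side : ∀ i, (ENNReal.ofReal ((z i + 1 : ℝ) / n - (z i : ℝ) / n)).toReal = (n : ℝ)⁻¹ := by
    intro i
    rw [← sub_div, add_sub_cancel_left, one_div, ENNReal.toReal_ofReal (by positivity)]
  simp [Measure.real, gridCell, Real.volume_pi_Ico, ENNReal.toReal_prod, side]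

variable [DecidableEq ι]

theorem unitCube_eq_biUnion_gridCell {n : ℕ} (hn : 1 ≤ n) :
    unitCube ι = ⋃ z ∈ Fintype.piFinset fun _ : ι => Finset.range n, gridCell n z := by
  have hn' : (0 : ℝ) < n := by exact_mod_cast hn
  have floor_lt : ∀ t : ℝ, 0 ≤ t → (⌊n * t⌋₊ < n ↔ t < 1) := fun t ht => by
    rw [Nat.floor_lt (by positivity), mul_lt_iff_lt_one_right hn']
  ext x
  simp only [unitCube, Set.mem_univ_pi, Set.mem_Ico, Set.mem_iUnion, exists_prop,
    mem_gridCell_iff hn, Fintype.mem_piFinset, Finset.mem_range]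
  constructor
  · intro hx
    exact ⟨_, fun i => (floor_lt _ (hx i).1).2 (hx i).2, fun i => (hx i).1, rfl⟩
  · rintro ⟨z, hz, h0, rfl⟩ i
    exact ⟨h0 i, (floor_lt _ (h0 i)).1 (hz i)⟩

variable {E : Type*} [NormedAddCommGroup E] [NormedSpace ℝ E]

theorem setIntegral_unitCube_floor [CompleteSpace E] {n : ℕ} (hn : 1 ≤ n) (f : (ι → ℕ) → E) :
    ∫ x in unitCube ι, f (fun i => ⌊n * x i⌋₊) =
      ((n : ℝ) ^ Fintype.card ι)⁻¹ • ∑ z ∈ Fintype.piFinset fun _ : ι => Finset.range n, f z := by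
  have const_on_cell : ∀ z,
      Set.EqOn (fun x : ι → ℝ => f fun i => ⌊n * x i⌋₊) (fun _ => f z) (gridCell n z) :=
    fun z x hx => congrArg f ((mem_gridCell_iff hn).1 hx).2
  have cells_disjoint : ∀ z z' : ι → ℕ, z ≠ z' → Disjoint (gridCell n z) (gridCell n z') := by
    refine fun z z' hne => Set.disjoint_left.2 fun x hx hx' => hne ?_
    exact ((mem_gridCell_iff hn).1 hx).2.symm.trans ((mem_gridCell_iff hn).1 hx').2
  rw [unitCube_eq_biUnion_gridCell hn,
    integral_biUnion_finset _ (fun z _ => measurableSet_gridCell n z)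
      (fun z _ z' _ => cells_disjoint z z')
      fun z _ => (integrableOn_congr_fun (const_on_cell z) (measurableSet_gridCell n z)).2
        (integrableOn_const (volume_gridCell_ne_top n z)),
    Finset.smul_sum]
  refine Finset.sum_congr rfl fun z _ => ?_
  rw [setIntegral_congr_fun (measurableSet_gridCell n z) (const_on_cell z), setIntegral_const,
    volume_real_gridCell]

theorem tendsto_riemannSum [CompleteSpace E] {f : ℕ → (ι → ℕ) → E} {C : ℝ}
    (hf : ∀ n, 1 ≤ n → ∀ z, ‖f n z‖ ≤ C) {g : (ι → ℝ) → E}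
    (hlim : ∀ᵐ x : ι → ℝ, x ∈ unitCube ι →
      Tendsto (fun n : ℕ => f n fun i => ⌊n * x i⌋₊) atTop (𝓝 (g x))) :
    Tendsto (fun n : ℕ => ((n : ℝ) ^ Fintype.card ι)⁻¹ •
        ∑ z ∈ Fintype.piFinset fun _ : ι => Finset.range n, f n z) atTop
      (𝓝 (∫ x in unitCube ι, g x)) := by
  have integral_limit : Tendsto (fun n : ℕ => ∫ x in unitCube ι, f n fun i => ⌊n * x i⌋₊) atTop
      (𝓝 (∫ x in unitCube ι, g x)) := by
    refine tendsto_integral_filter_of_dominated_convergence (fun _ => C) ?_ ?_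
      (integrableOn_const (by simp [volume_unitCube])) ?_
    · refine Eventually.of_forall fun n => ?_
      have floor_measurable : Measurable fun (x : ι → ℝ) (i : ι) => ⌊n * x i⌋₊ := by fun_prop
      exact ((StronglyMeasurable.of_discrete (f := f n)).comp_measurable
        floor_measurable).aestronglyMeasurable
    · filter_upwards [eventually_ge_atTop 1] with n hn
      exact Eventually.of_forall fun x => hf n hn _
    · exact (ae_restrict_iff' measurableSet_unitCube).2 hlim
  refine integral_limit.congr' ?_
  filter_upwards [eventually_ge_atTop 1] with n hn
  exact setIntegral_unitCube_floor hn _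

end RiemannSum

/-! ### Products of Toeplitz matrices as sums over lattice paths -/

/-- The path that starts at `i` and makes the steps `-κ s` stays in `[0, n)` and ends at `i`, or
at the mirror image of `i` if `e` holds. -/
def IsClosedPath (n : ℕ) (e : Bool) {r : ℕ} (κ : Fin r → ℤ) (i : ℤ) : Prop :=
  (∀ s, i - Fin.partialSum κ s ∈ Finset.Ico 0 (n : ℤ)) ∧
    i - Fin.partialSum κ (Fin.last r) = if e then n - 1 - i else i

noncomputable instance IsClosedPath.instDecidable (n : ℕ) (e : Bool) {r : ℕ} (κ : Fin r → ℤ)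
    (i : ℤ) : Decidable (IsClosedPath n e κ i) :=
  inferInstanceAs (Decidable (_ ∧ _))

/-- The backward identity if `e` holds, and the identity otherwise. -/
def flipMatrix (n : ℕ) (e : Bool) : Matrix (Fin n) (Fin n) ℂ :=
  if e then backwardIdentity n else 1

/-- The `n × n` matrix of the shift by `k`. -/
def shiftMatrix (n : ℕ) (k : ℤ) : Matrix (Fin n) (Fin n) ℂ := toeplitz n (Pi.single k 1)

theorem shiftMatrix_apply (n : ℕ) (k : ℤ) (i j : Fin n) :
    shiftMatrix n k i j = if (i : ℤ) - j = k then 1 else 0 := by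
  simp [shiftMatrix, toeplitz, Pi.single_apply]

@[simp]
theorem toeplitz_single_zero (n : ℕ) : toeplitz n (Pi.single 0 1) = 1 := by
  ext i j
  simp only [toeplitz, Matrix.of_apply, Pi.single_apply, Matrix.one_apply, sub_eq_zero,
    Nat.cast_inj, Fin.val_inj]

theorem toeplitz_eq_sum (n : ℕ) (b : ℤ → ℂ) :
    toeplitz n b = ∑ k ∈ Finset.Ioo (-n : ℤ) n, b k • shiftMatrix n k := by
  ext i j
  rw [Matrix.sum_apply, Finset.sum_eq_single ((i : ℤ) - j)]
  · simp [shiftMatrix_apply, toeplitz]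
  · intro k _ hk
    simp [shiftMatrix_apply, hk.symm]
  · exact fun hk => absurd (Finset.mem_Ioo.2 ⟨by omega, by omega⟩) hk

theorem prod_toeplitz_eq_sum (n : ℕ) {r : ℕ} (B : Fin r → ℤ → ℂ) :
    (List.ofFn fun s => toeplitz n (B s)).prod =
      ∑ κ ∈ Fintype.piFinset fun _ : Fin r => Finset.Ioo (-n : ℤ) n,
        (∏ s, B s (κ s)) • (List.ofFn fun s => shiftMatrix n (κ s)).prod := by
  simpa only [MultilinearMap.map_smul_univ, MultilinearMap.mkPiAlgebraFin_apply,
    ← toeplitz_eq_sum] using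
    (MultilinearMap.mkPiAlgebraFin ℂ r (Matrix (Fin n) (Fin n) ℂ)).map_sum_finset
      (fun s k => B s k • shiftMatrix n k) fun _ => Finset.Ioo (-n : ℤ) n

theorem shiftMatrix_mul_apply_of_eq {n : ℕ} {k : ℤ} {i i' : Fin n} (hi : (i : ℤ) - k = i')
    (A : Matrix (Fin n) (Fin n) ℂ) (j : Fin n) : (shiftMatrix n k * A) i j = A i' j := by
  rw [Matrix.mul_apply, Finset.sum_eq_single i']
  · simp [shiftMatrix_apply, ← hi]
  · intro l _ hl
    rw [shiftMatrix_apply, if_neg fun hk => hl (Fin.ext (by lia)), zero_mul]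
  · simp

theorem shiftMatrix_mul_apply_of_notMem {n : ℕ} {k : ℤ} {i : Fin n}
    (hi : (i : ℤ) - k ∉ Finset.Ico 0 (n : ℤ)) (A : Matrix (Fin n) (Fin n) ℂ) (j : Fin n) :
    (shiftMatrix n k * A) i j = 0 := by
  refine (Matrix.mul_apply ..).trans (Finset.sum_eq_zero fun l _ => ?_)
  rw [shiftMatrix_apply, if_neg fun hk => hi (Finset.mem_Ico.2 ⟨by omega, by omega⟩), zero_mul]

theorem prod_shiftMatrix_apply (n : ℕ) {r : ℕ} (κ : Fin r → ℤ) (i j : Fin n) :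
    (List.ofFn fun s => shiftMatrix n (κ s)).prod i j =
      if (∀ s, (i : ℤ) - Fin.partialSum κ s ∈ Finset.Ico 0 (n : ℤ)) ∧
        (i : ℤ) - Fin.partialSum κ (Fin.last r) = j then 1 else 0 := by
  induction r generalizing i with
  | zero => simp [Fin.forall_fin_one, Matrix.one_apply, Fin.ext_iff]
  | succ r ih =>
    have shift_start : ∀ s, (i : ℤ) - Fin.partialSum κ (Fin.succ s) =
        i - κ 0 - Fin.partialSum (Fin.tail κ) s := fun s => by
      rw [Fin.partialSum_succ', sub_add_eq_sub_sub]
    simp only [List.ofFn_succ, List.prod_cons, Fin.forall_fin_succ (n := r + 1), shift_start,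
      ← Fin.succ_last, Fin.partialSum_zero, sub_zero]
    by_cases hi : (i : ℤ) - κ 0 ∈ Finset.Ico 0 (n : ℤ)
    · obtain ⟨i', hi'⟩ : ∃ i' : Fin n, (i : ℤ) - κ 0 = i' :=
        ⟨⟨((i : ℤ) - κ 0).toNat, by rw [Finset.mem_Ico] at hi; omega⟩,
          (Int.toNat_of_nonneg (Finset.mem_Ico.1 hi).1).symm⟩
      have start_mem : (i : ℤ) ∈ Finset.Ico 0 (n : ℤ) := Finset.mem_Ico.2 ⟨by omega, by omega⟩
      rw [shiftMatrix_mul_apply_of_eq hi', hi']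
      exact (ih (Fin.tail κ) i').trans (if_congr (by simp only [start_mem, true_and]) rfl rfl)
    · rw [shiftMatrix_mul_apply_of_notMem hi, if_neg fun h => hi (by simpa using h.1.2 0)]

theorem mul_backwardIdentity_apply {n : ℕ} (A : Matrix (Fin n) (Fin n) ℂ) (i j : Fin n) :
    (A * backwardIdentity n) i j = A i j.rev := by
  rw [Matrix.mul_apply, Finset.sum_eq_single j.rev] <;>
    simp +contextual [backwardIdentity]

theorem prod_shiftMatrix_mul_flipMatrix_apply_self (n : ℕ) {r : ℕ} (κ : Fin r → ℤ) (e : Bool)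
    (i : Fin n) :
    ((List.ofFn fun s => shiftMatrix n (κ s)).prod * flipMatrix n e) i i =
      if IsClosedPath n e κ i then 1 else 0 := by
  cases e
  · simp [flipMatrix, prod_shiftMatrix_apply, IsClosedPath]
  · have rev_eq : ((Fin.rev i : ℕ) : ℤ) = n - 1 - i := by rw [Fin.val_rev]; omega
    simp only [flipMatrix, mul_backwardIdentity_apply, prod_shiftMatrix_apply, IsClosedPath, rev_eq,
      if_true]

theorem trace_prod_toeplitz (n : ℕ) {r : ℕ} (B : Fin r → ℤ → ℂ) (e : Bool) :
    ((List.ofFn fun s => toeplitz n (B s)).prod * flipMatrix n e).trace =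
      ∑ κ ∈ Fintype.piFinset fun _ : Fin r => Finset.Ioo (-n : ℤ) n, (∏ s, B s (κ s)) *
        ∑ i ∈ Finset.range n, if IsClosedPath n e κ i then 1 else 0 := by
  rw [prod_toeplitz_eq_sum, Finset.sum_mul, Matrix.trace_sum]
  refine Finset.sum_congr rfl fun κ _ => ?_
  rw [smul_mul_assoc, Matrix.trace_smul, smul_eq_mul, Matrix.trace, Finset.sum_range]
  simp only [Matrix.diag_apply, prod_shiftMatrix_mul_flipMatrix_apply_self]

/-! ### Coincidence patterns -/

/-- The indices with absolute values `z`, constant on the classes of `S`, and signs `σ`, where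
`true` stands for the negative sign. -/
def signedPoint {T : Type*} (S : Setoid T) (σ : T → Bool) (z : Quotient S → ℕ) (s : T) : ℤ :=
  negIf (σ s) (z (Quotient.mk S s))

/-- The entries with indices `k` in the copies `i` fall into the same blocks precisely as prescribed
by `S`, and the negative indices are those selected by `σ`. -/
def IsPattern {I T : Type*} (i : T → I) (S : Setoid T) (σ : T → Bool) (k : T → ℤ) : Prop :=
  Setoid.ker (blockIndex i k) = S ∧ (fun s => decide (k s < 0)) = σ

@[simp]
theorem natAbs_signedPoint {T : Type*} (S : Setoid T) (σ : T → Bool) (z : Quotient S → ℕ) (s : T) :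
    (signedPoint S σ z s).natAbs = z (Quotient.mk S s) := by
  rw [signedPoint, natAbs_negIf, Int.natAbs_natCast]

theorem IsPattern.signedPoint_natAbs_out {I T : Type*} {i : T → I} {S : Setoid T} {σ : T → Bool}
    {k : T → ℤ} (hk : IsPattern i S σ k) :
    signedPoint S σ (fun q => (k q.out).natAbs) = k := by
  obtain ⟨rfl, rfl⟩ := hk
  ext s
  have same_block : Setoid.ker (blockIndex i k) (Quotient.mk _ s).out s :=
    Quotient.exact (Quotient.out_eq _)
  have same_abs : (k (Quotient.mk _ s).out).natAbs = (k s).natAbs := (Prod.mk.inj same_block).2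
  simp only [signedPoint, same_abs, negIf, decide_eq_true_eq]
  split_ifs <;> omega

theorem isPattern_signedPoint_iff {I T : Type*} {i : T → I} {S : Setoid T} {σ : T → Bool}
    {z : Quotient S → ℕ} (hinj : Function.Injective z) (hpos : ∀ q, 0 < z q) :
    IsPattern i S σ (signedPoint S σ z) ↔ S ≤ Setoid.ker i := by
  refine ⟨fun h s s' hs => ?_, fun h => ⟨Setoid.ext fun s s' => ?_, funext fun s => ?_⟩⟩
  · rw [← h.1] at hs
    exact (Prod.mk.inj hs).1
  · simp only [Setoid.ker_def, blockIndex, natAbs_signedPoint, Prod.mk.injEq]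
    exact ⟨fun hs => Quotient.exact (hinj hs.2), fun hs => ⟨h hs, by rw [Quotient.sound hs]⟩⟩
  · cases hσ : σ s <;> simp [signedPoint, negIf, hσ, hpos]

noncomputable instance setoidFintype {T : Type*} [Finite T] : Fintype (Setoid T) :=
  have : Finite (Setoid T) :=
    Finite.of_injective (fun (S : Setoid T) (s s' : T) => S s s') fun _ _ h =>
      Setoid.ext fun s s' => iff_of_eq (congrFun (congrFun h s) s')
  Fintype.ofFinite _

section PatternSums

variable {I T : Type*} [Fintype T] [DecidableEq T]

open scoped Classical in
theorem sum_pattern_eq_sum_signedPoint (i : T → I) (S : Setoid T) (σ : T → Bool) (n : ℕ)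
    (F : (T → ℤ) → ℕ → ℂ) :
    ∑ x ∈ ((Fintype.piFinset fun _ : T => Finset.Ioo (-n : ℤ) n) ×ˢ Finset.range n).filter
        (fun x => IsPattern i S σ x.1), F x.1 x.2 =
      ∑ z ∈ (Fintype.piFinset fun _ : Option (Quotient S) => Finset.range n).filter
        (fun z => IsPattern i S σ (signedPoint S σ (z ∘ some))),
          F (signedPoint S σ (z ∘ some)) (z none) := by
  refine Finset.sum_bij' (fun x _ o => o.elim x.2 fun q => (x.1 q.out).natAbs)
    (fun z _ => (signedPoint S σ (z ∘ some), z none)) ?_ ?_ ?_ ?_ ?_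
  · rintro ⟨k, j⟩ hx
    simp only [Finset.mem_filter, Finset.mem_product, Fintype.mem_piFinset, Finset.mem_Ioo] at hx ⊢
    refine ⟨fun o => ?_, by exact hx.2.signedPoint_natAbs_out.symm ▸ hx.2⟩
    cases o with
    | none => exact hx.1.2
    | some q =>
      have := hx.1.1 q.out
      exact Finset.mem_range.2 (by simp only [Option.elim_some]; omega)
  · intro z hz
    simp only [Finset.mem_filter, Finset.mem_product, Fintype.mem_piFinset, Finset.mem_Ioo,
      Finset.mem_range] at hz ⊢
    refine ⟨⟨fun s => ?_, hz.1 none⟩, hz.2⟩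
    have abs_eq := natAbs_signedPoint S σ (z ∘ some) s
    have abs_lt := hz.1 (some (Quotient.mk S s))
    simp only [Function.comp_apply] at abs_eq
    omega
  · rintro ⟨k, j⟩ hx
    exact Prod.ext (Finset.mem_filter.1 hx).2.signedPoint_natAbs_out rfl
  · intro z _
    ext (_ | q)
    · rfl
    · simp [Quotient.out_eq]
  · rintro ⟨k, j⟩ hx
    exact congrArg (F · j) (Finset.mem_filter.1 hx).2.signedPoint_natAbs_out.symm

open scoped Classical in
theorem sum_eq_sum_patterns (i : T → I) (n : ℕ) (F : (T → ℤ) → ℕ → ℂ) :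
    ∑ k ∈ Fintype.piFinset fun _ : T => Finset.Ioo (-n : ℤ) n, ∑ j ∈ Finset.range n, F k j =
      ∑ S : Setoid T, ∑ σ : T → Bool,
        ∑ z ∈ Fintype.piFinset fun _ : Option (Quotient S) => Finset.range n,
          if IsPattern i S σ (signedPoint S σ (z ∘ some)) then
            F (signedPoint S σ (z ∘ some)) (z none) else 0 := by
  simp only [← Finset.sum_filter, ← sum_pattern_eq_sum_signedPoint]
  rw [← Finset.sum_product', ← Finset.sum_fiberwise _
    (fun x => (Setoid.ker (blockIndex i x.1), fun s => decide (x.1 s < 0))), Fintype.sum_prod_type]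
  refine Finset.sum_congr rfl fun S _ => Finset.sum_congr rfl fun σ _ =>
    Finset.sum_congr (Finset.filter_congr fun x _ => ?_) fun _ _ => rfl
  rw [IsPattern, Prod.mk.injEq]

end PatternSums

section Pairings

variable {T : Type*} [Fintype T] {S : Setoid T}

open scoped Classical in
theorem card_eq_sum_card_classes (S : Setoid T) :
    Fintype.card T = ∑ q : Quotient S, (Finset.univ.filter fun s => Quotient.mk S s = q).card :=
  Finset.card_eq_sum_card_fiberwise fun _ _ => Finset.mem_coe.2 (Finset.mem_univ _)

open scoped Classical in
theorem card_class (s : T) :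
    (Finset.univ.filter fun s' => Quotient.mk S s' = Quotient.mk S s).card =
      {s' | S s' s}.ncard := by
  rw [← Set.ncard_coe_finset]
  congr
  ext s'
  simp [Quotient.eq]

open scoped Classical in
theorem IsPairing.two_mul_card_quotient (hS : IsPairing S) :
    2 * Fintype.card (Quotient S) = Fintype.card T := by
  have card_eq_two : ∀ q : Quotient S,
      (Finset.univ.filter fun s => Quotient.mk S s = q).card = 2 := fun q => by
    obtain ⟨s, rfl⟩ := Quotient.exists_rep q
    rw [card_class, hS s]
  rw [card_eq_sum_card_classes S, Finset.sum_congr rfl fun q _ => card_eq_two q,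
    Finset.sum_const, Finset.card_univ, smul_eq_mul, mul_comm]

open scoped Classical in
theorem two_mul_card_quotient_lt (hne : ∀ s, ∃ s', S s' s ∧ s' ≠ s) (hS : ¬ IsPairing S) :
    2 * Fintype.card (Quotient S) < Fintype.card T := by
  have two_le : ∀ s, 2 ≤ {s' | S s' s}.ncard := fun s => by
    obtain ⟨s', hs', hs⟩ := hne s
    exact (Set.one_lt_ncard_iff_nontrivial).2 ⟨s', hs', s, S.refl s, hs⟩
  obtain ⟨s₀, hs₀⟩ := not_forall.1 hS
  calc 2 * Fintype.card (Quotient S) = ∑ _q : Quotient S, 2 := by simp [mul_comm]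
    _ < ∑ q : Quotient S, (Finset.univ.filter fun s => Quotient.mk S s = q).card := by
      refine Finset.sum_lt_sum (fun q _ => ?_) ⟨Quotient.mk S s₀, Finset.mem_univ _, ?_⟩
      · obtain ⟨s, rfl⟩ := Quotient.exists_rep q
        exact card_class s ▸ two_le s
      · exact card_class s₀ ▸ (two_le s₀).lt_of_ne' hs₀
    _ = Fintype.card T := (card_eq_sum_card_classes S).symm

end Pairings

/-! ### Limits of rescaled lattice paths -/

theorem partialSum_last {M : Type*} [AddCommMonoid M] {r : ℕ} (f : Fin r → M) :
    Fin.partialSum f (Fin.last r) = ∑ s, f s := by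
  rw [Fin.partialSum, Fin.val_last, List.take_of_length_le (by simp), List.sum_ofFn]

theorem eventually_lt_iff_of_tendsto_div {u v : ℕ → ℤ} {y z : ℝ}
    (hu : Tendsto (fun n => (u n : ℝ) / n) atTop (𝓝 y))
    (hv : Tendsto (fun n => (v n : ℝ) / n) atTop (𝓝 z)) (hne : y ≠ z) :
    ∀ᶠ n in atTop, u n < v n ↔ y < z := by
  have lt_iff_div_lt : ∀ᶠ n : ℕ in atTop, ∀ k k' : ℤ, (k : ℝ) / n < k' / n ↔ k < k' := by
    filter_upwards [eventually_gt_atTop 0] with n hn k k'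
    rw [div_lt_div_iff_of_pos_right (by exact_mod_cast hn), Int.cast_lt]
  rcases hne.lt_or_gt with h | h
  · filter_upwards [hu.eventually_lt hv h, lt_iff_div_lt] with n hn hn'
    exact iff_of_true ((hn' _ _).1 hn) h
  · filter_upwards [hv.eventually_lt hu h, lt_iff_div_lt] with n hn hn'
    exact iff_of_false ((hn' _ _).1 hn).asymm h.asymm

theorem eventually_ne_of_tendsto_div {u v : ℕ → ℤ} {y z : ℝ}
    (hu : Tendsto (fun n => (u n : ℝ) / n) atTop (𝓝 y))
    (hv : Tendsto (fun n => (v n : ℝ) / n) atTop (𝓝 z)) (hne : y ≠ z) :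
    ∀ᶠ n in atTop, u n ≠ v n :=
  ((hu.sub hv).eventually_ne (sub_ne_zero.2 hne)).mono fun n => mt fun h => by rw [h, sub_self]

theorem tendsto_natCast_div_natCast_add (c : ℝ) :
    Tendsto (fun n : ℕ => ((n : ℝ) + c) / n) atTop (𝓝 1) := by
  have h := (tendsto_const_div_atTop_nhds_zero_nat c).const_add 1
  rw [add_zero] at h
  refine h.congr' ?_
  filter_upwards [eventually_ne_atTop 0] with n hn
  field_simp

/-- The integer point near `n x`. -/
noncomputable def gridPoint {ι : Type*} (x : ι → ℝ) (n : ℕ) (o : ι) : ℕ := ⌊n * x o⌋₊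

theorem tendsto_gridPoint_div {ι : Type*} {x : ι → ℝ} {o : ι} (hx : 0 ≤ x o) :
    Tendsto (fun n : ℕ => ((gridPoint x n o : ℤ) : ℝ) / n) atTop (𝓝 (x o)) := by
  simpa only [Int.cast_natCast, Function.comp_def, gridPoint, mul_comm (x o)] using
    (tendsto_nat_floor_mul_div_atTop hx).comp (tendsto_natCast_atTop_atTop (R := ℝ))

/-- The family with parts `k` and `l` on the two sides of the predicate `p`. -/
def glue {ι α : Type*} (p : ι → Prop) [DecidablePred p] (k : {s // p s} → α) (l : {s // ¬ p s} → α)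
    (s : ι) : α :=
  if h : p s then k ⟨s, h⟩ else l ⟨s, h⟩

theorem sum_glue {ι M : Type*} [Fintype ι] [AddCommMonoid M] (p : ι → Prop) [DecidablePred p]
    (k : {s // p s} → M) (l : {s // ¬ p s} → M) :
    ∑ s, glue p k l s = ∑ s, k s + ∑ s, l s := by
  rw [← Fintype.sum_subtype_add_sum_subtype p]
  congr 1 <;> exact Finset.sum_congr rfl fun s _ => by simp [glue, s.2]

section Paths

variable {r : ℕ} (p : Fin r → Prop) [DecidablePred p] (S : Setoid {s // p s})
  (σ : {s // p s} → Bool)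

/-- The steps of the path whose random part has absolute values `z ∘ some` and whose deterministic
part is `l`; the coordinate `z none` is reserved for the starting point of the path. -/
def pathSteps (l : {s // ¬ p s} → ℤ) (z : Option (Quotient S) → ℕ) : Fin r → ℤ :=
  glue p (signedPoint S σ (z ∘ some)) l

/-- The step `s` in the limit, where the deterministic steps are negligible. -/
def stepForm (s : Fin r) : (Option (Quotient S) → ℝ) →ₗ[ℝ] ℝ :=
  if h : p s then (if σ ⟨s, h⟩ then (-1 : ℝ) else 1) •
    LinearMap.proj (some (Quotient.mk S ⟨s, h⟩)) else 0

/-- The position in the limit of the path after `s` steps. -/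
def positionForm (s : Fin (r + 1)) : (Option (Quotient S) → ℝ) →ₗ[ℝ] ℝ :=
  LinearMap.proj none - Fin.partialSum (stepForm p S σ) s

theorem stepForm_apply_natCast (z : Option (Quotient S) → ℕ) (s : Fin r) :
    stepForm p S σ s (fun o => (z o : ℝ)) = pathSteps p S σ 0 z s := by
  by_cases h : p s
  · cases hσ : σ ⟨s, h⟩ <;> simp [stepForm, pathSteps, glue, signedPoint, negIf, h, hσ]
  · simp [stepForm, pathSteps, glue, h]

theorem sum_signedPoint_eq_zero (h : ∑ s, stepForm p S σ s = 0)
    (z : Option (Quotient S) → ℕ) : ∑ s, signedPoint S σ (z ∘ some) s = 0 := by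
  have sum_steps : ((∑ s, pathSteps p S σ 0 z s : ℤ) : ℝ) = 0 := by
    simp only [Int.cast_sum, ← stepForm_apply_natCast, ← LinearMap.sum_apply, h,
      LinearMap.zero_apply]
  simpa only [pathSteps, sum_glue, Pi.zero_apply, Finset.sum_const_zero, add_zero,
    Int.cast_eq_zero] using sum_steps

variable {p S σ} {x : Option (Quotient S) → ℝ}

theorem tendsto_pathSteps_div (l : {s // ¬ p s} → ℤ) (hx : ∀ o, 0 ≤ x o) (s : Fin r) :
    Tendsto (fun n : ℕ => (pathSteps p S σ l (gridPoint x n) s : ℝ) / n) atTop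
      (𝓝 (stepForm p S σ s x)) := by
  by_cases h : p s
  · have := tendsto_gridPoint_div (hx (some (Quotient.mk S ⟨s, h⟩)))
    cases hσ : σ ⟨s, h⟩
    · simpa [pathSteps, glue, signedPoint, stepForm, negIf, h, hσ] using this
    · simpa [pathSteps, glue, signedPoint, stepForm, negIf, h, hσ, neg_div] using this.neg
  · simpa [pathSteps, glue, stepForm, h] using tendsto_const_div_atTop_nhds_zero_nat (l ⟨s, h⟩ : ℝ)

theorem tendsto_partialSum_div (l : {s // ¬ p s} → ℤ) (hx : ∀ o, 0 ≤ x o) (s : Fin (r + 1)) :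
    Tendsto (fun n : ℕ => ((Fin.partialSum (pathSteps p S σ l (gridPoint x n)) s : ℤ) : ℝ) / n)
      atTop (𝓝 (Fin.partialSum (stepForm p S σ) s x)) := by
  induction s using Fin.induction with
  | zero => simp
  | succ s ih =>
    simpa only [Fin.partialSum_succ, Int.cast_add, add_div, LinearMap.add_apply] using
      ih.add (tendsto_pathSteps_div l hx s)

theorem tendsto_position_div (l : {s // ¬ p s} → ℤ) (hx : ∀ o, 0 ≤ x o) (s : Fin (r + 1)) :
    Tendsto (fun n : ℕ => (((gridPoint x n none : ℤ) -
      Fin.partialSum (pathSteps p S σ l (gridPoint x n)) s : ℤ) : ℝ) / n) atTop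
      (𝓝 (positionForm p S σ s x)) := by
  simpa only [Int.cast_sub, Int.cast_natCast, sub_div, positionForm, LinearMap.sub_apply,
    LinearMap.proj_apply]
    using (tendsto_gridPoint_div (hx none)).sub (tendsto_partialSum_div l hx s)

variable (p S σ) in
/-- The points at which no inequality or equation between limits of rescaled paths is decided by
lower order terms. -/
structure IsGeneric (x : Option (Quotient S) → ℝ) : Prop where
  label_ne_zero : ∀ q, x (some q) ≠ 0
  label_injective : Function.Injective (x ∘ some)
  position_ne_zero : ∀ s, positionForm p S σ s x ≠ 0
  position_ne_one : ∀ s, positionForm p S σ s x ≠ 1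
  sum_step_ne_zero : ∑ s, stepForm p S σ s ≠ 0 → (∑ s, stepForm p S σ s) x ≠ 0
  reflected_ne_one : x none + positionForm p S σ (Fin.last r) x ≠ 1

theorem stepForm_single_none [DecidableEq (Quotient S)] (s : Fin r) :
    stepForm p S σ s (Pi.single none 1) = 0 := by
  rw [stepForm]
  split_ifs <;> simp

theorem positionForm_single_none [DecidableEq (Quotient S)] (s : Fin (r + 1)) :
    positionForm p S σ s (Pi.single none 1) = 1 := by
  have partialSum_eq_zero : Fin.partialSum (stepForm p S σ) s (Pi.single none 1) = 0 := by
    induction s using Fin.induction with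
    | zero => rw [Fin.partialSum_zero, LinearMap.zero_apply]
    | succ s ih => rw [Fin.partialSum_succ, LinearMap.add_apply, ih, stepForm_single_none, add_zero]
  simp [positionForm, partialSum_eq_zero]

open scoped Classical in
theorem ae_isGeneric : ∀ᵐ x, IsGeneric p S σ x := by
  have position_ne : ∀ c : ℝ, ∀ᵐ x, ∀ s, positionForm p S σ s x ≠ c := fun c =>
    ae_all_iff.2 fun s => ae_linearMap_ne (fun h => one_ne_zero
      ((positionForm_single_none (p := p) (σ := σ) s).symm.trans (by rw [h]; rfl))) c
  have label_ne : ∀ᵐ x : Option (Quotient S) → ℝ, ∀ q, x (some q) ≠ 0 :=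
    ae_all_iff.2 fun q => ae_linearMap_ne (L := LinearMap.proj (some q))
      (fun h => by simpa using LinearMap.congr_fun h (Pi.single (some q) 1)) 0
  have labels_ne : ∀ᵐ x : Option (Quotient S) → ℝ, ∀ q q', q ≠ q' →
      x (some q) - x (some q') ≠ 0 := by
    let label (q : Quotient S) : (Option (Quotient S) → ℝ) →ₗ[ℝ] ℝ := LinearMap.proj (some q)
    simp only [ae_all_iff]
    exact fun q q' hq => ae_linearMap_ne (L := label q - label q')
      (fun h => by simpa [label, hq.symm] using LinearMap.congr_fun h (Pi.single (some q) 1)) 0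
  have sum_ne : ∑ s, stepForm p S σ s ≠ 0 → ∀ᵐ x, (∑ s, stepForm p S σ s) x ≠ 0 :=
    fun h => ae_linearMap_ne h 0
  have reflected_ne := ae_linearMap_ne
    (L := LinearMap.proj none + positionForm p S σ (Fin.last r))
    (fun h => by
      have := LinearMap.congr_fun h (Pi.single none 1)
      norm_num [positionForm_single_none] at this) 1
  filter_upwards [label_ne, labels_ne, position_ne 0, position_ne 1, ae_all_iff.2 sum_ne,
    reflected_ne] with x h₁ h₂ h₃ h₄ h₅ h₆
  exact ⟨h₁, fun q q' h => by_contra fun hq => h₂ q q' hq (sub_eq_zero.2 h), h₃, h₄, h₅, h₆⟩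

theorem IsGeneric.eventually_position_mem_iff (h : IsGeneric p S σ x) (l : {s // ¬ p s} → ℤ)
    (hx : ∀ o, 0 ≤ x o) :
    ∀ᶠ n : ℕ in atTop, ∀ s, (gridPoint x n none : ℤ) -
        Fin.partialSum (pathSteps p S σ l (gridPoint x n)) s ∈ Finset.Ico 0 (n : ℤ) ↔
      positionForm p S σ s x ∈ Set.Ioo 0 1 := by
  refine eventually_all.2 fun s => ?_
  have tendsto_position := tendsto_position_div (σ := σ) l hx s
  filter_upwards [
    eventually_lt_iff_of_tendsto_div (v := fun _ => 0) tendsto_position (by simp)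
      (h.position_ne_zero s),
    eventually_lt_iff_of_tendsto_div (v := fun n => n) tendsto_position
      (by simpa using tendsto_natCast_div_natCast_add 0) (h.position_ne_one s)]
    with n neg_iff lt_iff
  rw [Finset.mem_Ico, Set.mem_Ioo, lt_iff, ← not_lt, neg_iff, not_lt,
    (h.position_ne_zero s).symm.le_iff_lt]

theorem IsGeneric.eventually_closed_iff (h : IsGeneric p S σ x) (l : {s // ¬ p s} → ℤ)
    (hx : ∀ o, 0 ≤ x o) :
    ∀ᶠ n : ℕ in atTop, (gridPoint x n none : ℤ) -
        Fin.partialSum (pathSteps p S σ l (gridPoint x n)) (Fin.last r) = gridPoint x n none ↔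
      ∑ s, stepForm p S σ s = 0 ∧ ∑ s, l s = 0 := by
  simp only [sub_eq_self]
  by_cases h0 : ∑ s, stepForm p S σ s = 0
  · refine Eventually.of_forall fun n => ?_
    rw [partialSum_last, pathSteps, sum_glue, sum_signedPoint_eq_zero p S σ h0, zero_add,
      and_iff_right h0]
  · have tendsto_total := tendsto_partialSum_div (σ := σ) l hx (Fin.last r)
    rw [partialSum_last (stepForm p S σ)] at tendsto_total
    filter_upwards [eventually_ne_of_tendsto_div (v := fun _ => 0) tendsto_total (by simp)
      (h.sum_step_ne_zero h0)] with n hn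
    simp only [hn, h0, false_and]

theorem IsGeneric.eventually_not_reflected (h : IsGeneric p S σ x) (l : {s // ¬ p s} → ℤ)
    (hx : ∀ o, 0 ≤ x o) :
    ∀ᶠ n : ℕ in atTop, (gridPoint x n none : ℤ) -
        Fin.partialSum (pathSteps p S σ l (gridPoint x n)) (Fin.last r) ≠
      n - 1 - gridPoint x n none := by
  have tendsto_reflected := (tendsto_gridPoint_div (hx none)).add
    (tendsto_position_div (σ := σ) l hx (Fin.last r))
  filter_upwards [eventually_ne_of_tendsto_div
    (u := fun n => gridPoint x n none + ((gridPoint x n none : ℤ) -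
      Fin.partialSum (pathSteps p S σ l (gridPoint x n)) (Fin.last r)))
    (v := fun n => n - 1) (by simpa [add_div] using tendsto_reflected)
    (by simpa [sub_eq_add_neg] using tendsto_natCast_div_natCast_add (-1)) h.reflected_ne_one]
    with n hn
  lia

theorem IsGeneric.eventually_isClosedPath_iff (h : IsGeneric p S σ x) (e : Bool)
    (l : {s // ¬ p s} → ℤ) (hx : ∀ o, 0 ≤ x o) :
    ∀ᶠ n : ℕ in atTop,
      IsClosedPath n e (pathSteps p S σ l (gridPoint x n)) (gridPoint x n none) ↔
        (∀ s, positionForm p S σ s x ∈ Set.Ioo 0 1) ∧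
          e = false ∧ ∑ s, stepForm p S σ s = 0 ∧ ∑ s, l s = 0 := by
  cases e
  · filter_upwards [h.eventually_position_mem_iff l hx, h.eventually_closed_iff l hx]
      with n mem_iff closed_iff
    simp only [IsClosedPath, mem_iff, Bool.false_eq_true, if_false, closed_iff, true_and]
  · filter_upwards [h.eventually_not_reflected l hx] with n hn
    simp only [IsClosedPath, if_true, hn, and_false, reduceCtorEq, false_and]

theorem IsGeneric.eventually_injective_label (h : IsGeneric p S σ x) (hx : ∀ o, 0 ≤ x o) :
    ∀ᶠ n : ℕ in atTop, Function.Injective (gridPoint x n ∘ some) := by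
  have labels_ne : ∀ᶠ n : ℕ in atTop, ∀ q q', q ≠ q' →
      (gridPoint x n (some q) : ℤ) ≠ gridPoint x n (some q') := by
    simp only [eventually_all]
    exact fun q q' hq => eventually_ne_of_tendsto_div (tendsto_gridPoint_div (hx (some q)))
      (tendsto_gridPoint_div (hx (some q'))) (h.label_injective.ne hq)
  filter_upwards [labels_ne] with n hn q q' hq
  exact by_contra fun hne => hn q q' hne (by exact_mod_cast hq)

theorem IsGeneric.eventually_label_pos (h : IsGeneric p S σ x) (hx : ∀ o, 0 ≤ x o) :
    ∀ᶠ n : ℕ in atTop, ∀ q, 0 < gridPoint x n (some q) := by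
  refine eventually_all.2 fun q => ?_
  filter_upwards [eventually_ne_of_tendsto_div (v := fun _ => 0)
    (tendsto_gridPoint_div (hx (some q))) (by simp) (h.label_ne_zero q)] with n hn
  exact Nat.pos_of_ne_zero (by exact_mod_cast hn)

end Paths

/-! ### Asymptotics of path sums -/

/-- What the limit needs to know about the moments `M n k` of entries with indices `k` in the copies
`i`: they are bounded, they vanish if some entry is alone in its block, and for paired blocks they
depend only on the pairing and on the signs of the indices. -/
structure IsPairedMoment {I T : Type*} (i : T → I) (M : ℕ → (T → ℤ) → ℂ) (C : ℝ) : Prop where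
  norm_le : ∀ n, 1 ≤ n → ∀ k, ‖M n k‖ ≤ C
  eq_zero : ∀ n, 1 ≤ n → ∀ k s, (∀ s', blockIndex i k s' = blockIndex i k s → s' = s) → M n k = 0
  congr : ∀ n n', 1 ≤ n → 1 ≤ n' → ∀ S, IsPairing S → ∀ k k', S = Setoid.ker (blockIndex i k) →
    S = Setoid.ker (blockIndex i k') → (∀ s, 0 < k s * k' s) → M n k = M n' k'

theorem isPairedMoment_one {I T : Type*} [IsEmpty T] (i : T → I) :
    IsPairedMoment i (fun _ _ => 1) 1 where
  norm_le _ _ _ := norm_one.le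
  eq_zero _ _ _ s := isEmptyElim s
  congr _ _ _ _ _ _ _ _ _ _ _ := rfl

open scoped Classical in
/-- The common value of the moments of entries that are paired by `S` and have signs `σ`, read off
at one choice of distinct positive absolute values. -/
noncomputable def pairedValue {T : Type*} [Fintype T] (M : ℕ → (T → ℤ) → ℂ) (S : Setoid T)
    (σ : T → Bool) : ℂ :=
  M 1 (signedPoint S σ fun q => Fintype.equivFin (Quotient S) q + 1)

theorem IsPairedMoment.eq_pairedValue {I T : Type*} [Fintype T] {i : T → I}
    {M : ℕ → (T → ℤ) → ℂ} {C : ℝ} (hM : IsPairedMoment i M C) {S : Setoid T} (hS : IsPairing S)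
    (hi : S ≤ Setoid.ker i) {n : ℕ} (hn : 1 ≤ n) (σ : T → Bool) {z : Quotient S → ℕ}
    (hinj : Function.Injective z) (hpos : ∀ q, 0 < z q) :
    M n (signedPoint S σ z) = pairedValue M S σ := by
  classical
  have enum_inj : Function.Injective fun q => (Fintype.equivFin (Quotient S) q : ℕ) + 1 :=
    fun q q' h => (Fintype.equivFin _).injective (Fin.ext (Nat.succ_injective h))
  refine hM.congr n 1 hn le_rfl S hS _ _
    ((isPattern_signedPoint_iff (σ := σ) hinj hpos).2 hi).1.symm
    ((isPattern_signedPoint_iff (σ := σ) enum_inj fun q => Nat.succ_pos _).2 hi).1.symm fun s => ?_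
  rw [signedPoint, signedPoint, negIf_mul_negIf]
  exact mul_pos (by exact_mod_cast hpos _) (by positivity)

theorem norm_riemannSum_le {ι E : Type*} [Fintype ι] [DecidableEq ι] [NormedAddCommGroup E]
    [NormedSpace ℝ E] {f : (ι → ℕ) → E} {C : ℝ} (hf : ∀ z, ‖f z‖ ≤ C) (n : ℕ) :
    ‖((n : ℝ) ^ Fintype.card ι)⁻¹ • ∑ z ∈ Fintype.piFinset fun _ : ι => Finset.range n, f z‖ ≤
      C := by
  have C_nonneg : 0 ≤ C := (norm_nonneg _).trans (hf 0)
  have norm_sum_le_card : ‖∑ z ∈ Fintype.piFinset fun _ : ι => Finset.range n, f z‖ ≤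
      (n : ℝ) ^ Fintype.card ι * C :=
    (norm_sum_le_of_le _ fun z _ => hf z).trans_eq (by simp)
  rw [norm_smul, Real.norm_of_nonneg (by positivity)]
  calc _ ≤ ((n : ℝ) ^ Fintype.card ι)⁻¹ * ((n : ℝ) ^ Fintype.card ι * C) := by gcongr
    _ ≤ C := by
      rw [← mul_assoc]
      exact mul_le_of_le_one_left C_nonneg inv_mul_le_one

theorem inv_mul_inv_sqrt_pow {n t q : ℕ} (h : 2 * q ≤ t) :
    (n : ℝ)⁻¹ * (√n)⁻¹ ^ t = (√n)⁻¹ ^ (t - 2 * q) * ((n : ℝ) ^ (q + 1))⁻¹ := by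
  have inv_sqrt_sq : (√n)⁻¹ ^ 2 = (n : ℝ)⁻¹ := by rw [inv_pow, Real.sq_sqrt n.cast_nonneg]
  obtain ⟨k, rfl⟩ := Nat.exists_eq_add_of_le h
  rw [Nat.add_sub_cancel_left, pow_add, pow_mul, inv_sqrt_sq, ← inv_pow, pow_succ]
  ring

theorem tendsto_inv_sqrt_pow {k : ℕ} (hk : k ≠ 0) :
    Tendsto (fun n : ℕ => (√n)⁻¹ ^ k) atTop (𝓝 0) := by
  have h := (tendsto_inv_atTop_zero.comp
    (Real.tendsto_sqrt_atTop.comp tendsto_natCast_atTop_atTop)).pow (l := atTop (α := ℕ)) k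
  rwa [zero_pow hk] at h

section PatternSums

variable {I : Type*} {r : ℕ} {p : Fin r → Prop} [DecidablePred p] (i : {s // p s} → I)
  (M : ℕ → ({s // p s} → ℤ) → ℂ) (e : Bool) (S : Setoid {s // p s}) (σ : {s // p s} → Bool)
  (l : {s // ¬ p s} → ℤ) (n : ℕ)

open scoped Classical in
/-- The contribution of one lattice point to the sum over a pattern. -/
noncomputable def patternTerm (z : Option (Quotient S) → ℕ) : ℂ :=
  if IsPattern i S σ (signedPoint S σ (z ∘ some)) then
    M n (signedPoint S σ (z ∘ some)) *
      if IsClosedPath n e (pathSteps p S σ l z) (z none) then 1 else 0 else 0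

open scoped Classical in
/-- The part of `pathSum` with pattern `S`, `σ`. -/
noncomputable def patternSum : ℂ :=
  ((n : ℝ)⁻¹ * (√n)⁻¹ ^ Fintype.card {s // p s}) •
    ∑ z ∈ Fintype.piFinset fun _ : Option (Quotient S) => Finset.range n,
      patternTerm i M e S σ l n z

/-- The sum over the closed lattice paths with deterministic steps `l`, where the random steps `k`
have weight `M n k`. -/
noncomputable def pathSum : ℂ :=
  ((n : ℝ)⁻¹ * (√n)⁻¹ ^ Fintype.card {s // p s}) •
    ∑ k ∈ Fintype.piFinset fun _ : {s // p s} => Finset.Ioo (-n : ℤ) n, M n k *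
      ∑ j ∈ Finset.range n, if IsClosedPath n e (glue p k l) j then 1 else 0

/-- The points of the unit cube whose limiting path stays in the unit interval. -/
def stayingSet (p : Fin r → Prop) [DecidablePred p] (S : Setoid {s // p s})
    (σ : {s // p s} → Bool) : Set (Option (Quotient S) → ℝ) :=
  {x | ∀ s, positionForm p S σ s x ∈ Set.Ioo 0 1}

open scoped Classical in
/-- The limit of `patternSum` for deterministic steps of sum zero. -/
noncomputable def patternLimit : ℂ :=
  if IsPairing S ∧ S ≤ Setoid.ker i ∧ e = false ∧ ∑ s, stepForm p S σ s = 0 then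
    volume.real (unitCube (Option (Quotient S)) ∩ stayingSet p S σ) • pairedValue M S σ
  else 0

/-- The limit of `pathSum` for deterministic steps of sum zero. -/
noncomputable def pathLimit : ℂ := ∑ S, ∑ σ, patternLimit i M e S σ

theorem pathSum_eq_sum_patternSum :
    pathSum M e l n = ∑ S, ∑ σ, patternSum i M e S σ l n := by
  simp only [pathSum, patternSum, patternTerm, pathSteps, ← Finset.smul_sum]
  simp only [Finset.mul_sum (Finset.range n)]
  rw [sum_eq_sum_patterns i]
  congr! 6

variable {i M e S σ l n} {C : ℝ}

theorem IsPairedMoment.norm_patternTerm_le (hM : IsPairedMoment i M C) (hn : 1 ≤ n)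
    (z : Option (Quotient S) → ℕ) : ‖patternTerm i M e S σ l n z‖ ≤ C := by
  have moment_le := hM.norm_le n hn (signedPoint S σ (z ∘ some))
  have C_nonneg : 0 ≤ C := (norm_nonneg _).trans moment_le
  rw [patternTerm]
  split_ifs <;> simp [C_nonneg, moment_le]

theorem IsPairedMoment.patternSum_eq_zero (hM : IsPairedMoment i M C) (hn : 1 ≤ n)
    {s : {s // p s}} (hs : ∀ s', S s' s → s' = s) : patternSum i M e S σ l n = 0 := by
  rw [patternSum, Finset.sum_eq_zero, smul_zero]
  intro z _
  rw [patternTerm]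
  by_cases hz : IsPattern i S σ (signedPoint S σ (z ∘ some))
  · rw [if_pos hz, hM.eq_zero n hn _ s fun s' h => hs s' (by rw [← hz.1]; exact h), zero_mul]
  · rw [if_neg hz]

open scoped Classical in
theorem patternSum_eq_smul_riemannSum
    (h : 2 * Fintype.card (Quotient S) ≤ Fintype.card {s // p s}) :
    patternSum i M e S σ l n =
      (√n)⁻¹ ^ (Fintype.card {s // p s} - 2 * Fintype.card (Quotient S)) •
        ((n : ℝ) ^ Fintype.card (Option (Quotient S)))⁻¹ •
          ∑ z ∈ Fintype.piFinset fun _ : Option (Quotient S) => Finset.range n,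
            patternTerm i M e S σ l n z := by
  rw [patternSum, inv_mul_inv_sqrt_pow h, mul_smul, Fintype.card_option]

theorem IsPairedMoment.norm_patternSum_le (hM : IsPairedMoment i M C) (hn : 1 ≤ n) :
    ‖patternSum i M e S σ l n‖ ≤ C := by
  classical
  have C_nonneg : 0 ≤ C := (norm_nonneg _).trans (hM.norm_le n hn 0)
  by_cases hne : ∀ s, ∃ s', S s' s ∧ s' ≠ s
  · have two_mul_card_le : 2 * Fintype.card (Quotient S) ≤ Fintype.card {s // p s} := by
      by_cases hS : IsPairing S
      · exact hS.two_mul_card_quotient.le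
      · exact (two_mul_card_quotient_lt hne hS).le
    have inv_sqrt_le_one : (√n)⁻¹ ≤ 1 :=
      inv_le_one_of_one_le₀ (Real.one_le_sqrt.2 (by exact_mod_cast hn))
    rw [patternSum_eq_smul_riemannSum two_mul_card_le, norm_smul,
      Real.norm_of_nonneg (by positivity)]
    exact (mul_le_of_le_one_left (norm_nonneg _)
      (pow_le_one₀ (by positivity) inv_sqrt_le_one)).trans
      (norm_riemannSum_le (hM.norm_patternTerm_le hn) n)
  · push Not at hne
    obtain ⟨s, hs⟩ := hne
    rwa [hM.patternSum_eq_zero hn hs, norm_zero]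

theorem IsPairedMoment.norm_pathSum_le (hM : IsPairedMoment i M C) (hn : 1 ≤ n) :
    ‖pathSum M e l n‖ ≤ ∑ _S : Setoid {s // p s}, ∑ _σ : {s // p s} → Bool, C := by
  rw [pathSum_eq_sum_patternSum i]
  exact norm_sum_le_of_le _ fun S _ => norm_sum_le_of_le _ fun σ _ => hM.norm_patternSum_le hn

open scoped Classical in
theorem IsPairedMoment.tendsto_patternTerm (hM : IsPairedMoment i M C) (hS : IsPairing S)
    {x : Option (Quotient S) → ℝ} (hx : ∀ o, 0 ≤ x o) (h : IsGeneric p S σ x) :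
    Tendsto (fun n : ℕ => patternTerm i M e S σ l n (gridPoint x n)) atTop
      (𝓝 (if S ≤ Setoid.ker i ∧ x ∈ stayingSet p S σ ∧
        e = false ∧ ∑ s, stepForm p S σ s = 0 ∧ ∑ s, l s = 0 then pairedValue M S σ else 0)) := by
  refine tendsto_const_nhds.congr' ?_
  filter_upwards [h.eventually_injective_label hx, h.eventually_label_pos hx,
    h.eventually_isClosedPath_iff e l hx, eventually_ge_atTop 1] with n hinj hpos hclosed hn
  by_cases hi : S ≤ Setoid.ker i
  · rw [patternTerm, if_pos ((isPattern_signedPoint_iff hinj hpos).2 hi),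
      hM.eq_pairedValue hS hi hn σ hinj hpos, mul_ite, mul_one, mul_zero]
    exact if_congr ((and_iff_right hi).trans hclosed.symm) rfl rfl
  · rw [patternTerm, if_neg (mt (isPattern_signedPoint_iff hinj hpos).1 hi), if_neg (hi ·.1)]

theorem measurableSet_stayingSet : MeasurableSet (stayingSet p S σ) := by
  classical
  refine MeasurableSet.congr (.iInter fun s => ?_) (Set.ofPred_forall _).symm
  exact (positionForm p S σ s).continuous_of_finiteDimensional.measurable measurableSet_Ioo

theorem IsPairedMoment.tendsto_patternSum_of_isPairing (hM : IsPairedMoment i M C)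
    (hS : IsPairing S) :
    Tendsto (fun n => patternSum i M e S σ l n) atTop
      (𝓝 (if ∑ s, l s = 0 then patternLimit i M e S σ else 0)) := by
  classical
  have tendsto_integral := tendsto_riemannSum
    (fun n hn z => hM.norm_patternTerm_le (e := e) (S := S) (σ := σ) (l := l) hn z)
    (ae_isGeneric.mono fun x h hx =>
      hM.tendsto_patternTerm hS (fun o => (hx o (Set.mem_univ o)).1) h)
  simp only [patternSum_eq_smul_riemannSum hS.two_mul_card_quotient.le,
    hS.two_mul_card_quotient, Nat.sub_self, pow_zero, one_smul]
  convert tendsto_integral using 2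
  by_cases hc : S ≤ Setoid.ker i ∧ e = false ∧ ∑ s, stepForm p S σ s = 0 ∧ ∑ s, l s = 0
  · obtain ⟨hi, he, hstep, hl⟩ := hc
    simp only [patternLimit, hS, hi, he, hstep, hl, if_true, true_and, and_true]
    rw [← setIntegral_const, ← setIntegral_indicator measurableSet_stayingSet]
    rfl
  · rw [integral_congr_ae (g := fun _ => 0) (.of_forall fun x => if_neg fun h => hc
      ⟨h.1, h.2.2⟩), integral_zero, ite_eq_right_iff]
    exact fun hl => if_neg fun h => hc ⟨h.2.1, h.2.2.1, h.2.2.2, hl⟩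

theorem IsPairedMoment.tendsto_patternSum_of_not_isPairing (hM : IsPairedMoment i M C)
    (hS : ¬ IsPairing S) : Tendsto (fun n => patternSum i M e S σ l n) atTop (𝓝 0) := by
  classical
  by_cases hne : ∀ s, ∃ s', S s' s ∧ s' ≠ s
  · have card_lt := two_mul_card_quotient_lt hne hS
    simp only [patternSum_eq_smul_riemannSum card_lt.le]
    refine (tendsto_inv_sqrt_pow (Nat.sub_ne_zero_of_lt card_lt)).zero_smul_isBoundedUnder_le
      (isBoundedUnder_of_eventually_le (a := C) ?_)
    filter_upwards [eventually_ge_atTop 1] with n hn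
    exact norm_riemannSum_le (hM.norm_patternTerm_le hn) n
  · push Not at hne
    obtain ⟨s, hs⟩ := hne
    refine tendsto_const_nhds.congr' ?_
    filter_upwards [eventually_ge_atTop 1] with n hn
    exact (hM.patternSum_eq_zero hn hs).symm

theorem IsPairedMoment.tendsto_pathSum (hM : IsPairedMoment i M C) :
    Tendsto (fun n => pathSum M e l n) atTop
      (𝓝 (if ∑ s, l s = 0 then pathLimit i M e else 0)) := by
  have tendsto_patternSum : ∀ S σ, Tendsto (fun n => patternSum i M e S σ l n) atTop
      (𝓝 (if ∑ s, l s = 0 then patternLimit i M e S σ else 0)) := by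
    intro S σ
    by_cases hS : IsPairing S
    · exact hM.tendsto_patternSum_of_isPairing hS
    · have limit_eq : patternLimit i M e S σ = 0 := if_neg fun h => hS h.1
      rw [limit_eq, ite_self]
      exact hM.tendsto_patternSum_of_not_isPairing hS
  have limit_eq : (if ∑ s, l s = 0 then pathLimit i M e else 0) =
      ∑ S, ∑ σ, if ∑ s, l s = 0 then patternLimit i M e S σ else 0 := by
    split_ifs <;> simp [pathLimit]
  simp only [pathSum_eq_sum_patternSum i, limit_eq]
  exact tendsto_finsetSum _ fun S _ => tendsto_finsetSum _ fun σ _ => tendsto_patternSum S σ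

theorem pathLimit_eq_zero_of_odd (hodd : Odd (Fintype.card {s // p s})) :
    pathLimit i M e = 0 := by
  refine Finset.sum_eq_zero fun S _ => Finset.sum_eq_zero fun σ _ => if_neg fun h => ?_
  classical
  rw [← h.1.two_mul_card_quotient] at hodd
  exact Nat.not_even_iff_odd.2 hodd (even_two_mul _)

theorem pathLimit_true : pathLimit i M true = 0 :=
  Finset.sum_eq_zero fun _ _ => Finset.sum_eq_zero fun _ _ => if_neg fun h => by simp at h

theorem pathLimit_one [IsEmpty {s // p s}] : pathLimit i (fun _ _ => 1) false = 1 := by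
  have tendsto_limit := (isPairedMoment_one i).tendsto_pathSum (e := false) (l := 0)
  simp only [Pi.zero_apply, Finset.sum_const_zero, if_true] at tendsto_limit
  refine tendsto_nhds_unique tendsto_limit (tendsto_const_nhds.congr' ?_)
  filter_upwards [eventually_ne_atTop 0] with n hn
  have glue_eq_zero : ∀ k : {s // p s} → ℤ, glue p k 0 = 0 := fun k =>
    funext fun s => dif_neg fun hs => isEmptyElim (⟨s, hs⟩ : {s // p s})
  have closed : ∀ j ∈ Finset.range n, IsClosedPath n false (0 : Fin r → ℤ) j := fun j hj => by
    have partialSum_zero : ∀ s, Fin.partialSum (0 : Fin r → ℤ) s = 0 := fun s => by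
      induction s using Fin.induction with
      | zero => exact Fin.partialSum_zero _
      | succ s ih => rw [Fin.partialSum_succ, ih, Pi.zero_apply, add_zero]
    simpa [IsClosedPath, partialSum_zero] using hj
  simp only [pathSum, glue_eq_zero, Finset.sum_congr rfl fun j hj => if_pos (closed j hj)]
  simp [hn]

end PatternSums

/-! ### Deterministic steps -/

theorem summable_prod_pi {D K : Type*} [Fintype D] {f : D → K → ℝ} (h0 : ∀ s k, 0 ≤ f s k)
    (hf : ∀ s, Summable (f s)) : Summable fun l : D → K => ∏ s, f s (l s) := by
  classical
  refine summable_of_sum_le (c := ∏ s, ∑' k, f s k)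
    (fun l => Finset.prod_nonneg fun s _ => h0 s _) fun u => ?_
  calc ∑ l ∈ u, ∏ s, f s (l s) ≤
      ∑ l ∈ Fintype.piFinset fun s => u.image fun l => l s, ∏ s, f s (l s) := by
        refine Finset.sum_le_sum_of_subset_of_nonneg (fun l hl => ?_)
          fun l _ _ => Finset.prod_nonneg fun s _ => h0 s _
        exact Fintype.mem_piFinset.2 fun s => Finset.mem_image_of_mem _ hl
    _ = ∏ s, ∑ k ∈ u.image fun l => l s, f s k := (Finset.prod_univ_sum _ _).symm
    _ ≤ _ := Finset.prod_le_prod (fun s _ => Finset.sum_nonneg fun k _ => h0 s k)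
        fun s _ => (hf s).sum_le_tsum _ fun k _ => h0 s k

theorem sum_piFinset_glue {ι α E : Type*} [Fintype ι] [DecidableEq ι] [AddCommMonoid E]
    (p : ι → Prop) [DecidablePred p] (A : Finset α) (F : (ι → α) → E) :
    ∑ κ ∈ Fintype.piFinset fun _ => A, F κ =
      ∑ l ∈ Fintype.piFinset fun _ : {s // ¬ p s} => A,
        ∑ k ∈ Fintype.piFinset fun _ : {s // p s} => A, F (glue p k l) := by
  rw [← Finset.sum_product_right']
  symm
  refine Finset.sum_equiv (Equiv.piEquivPiSubtypeProd p fun _ => α).symm (fun x => ?_)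
    fun _ _ => rfl
  simp only [Finset.mem_product, Fintype.mem_piFinset, Equiv.piEquivPiSubtypeProd_symm_apply]
  exact ⟨fun hx s => by split_ifs with h; exacts [hx.1 ⟨s, h⟩, hx.2 ⟨s, h⟩],
    fun hx => ⟨fun s => by simpa [s.2] using hx s, fun s => by simpa [s.2] using hx s⟩⟩

theorem prod_glue_apply {ι α M : Type*} [Fintype ι] [CommMonoid M] (p : ι → Prop)
    [DecidablePred p] (b : {s // p s} → α → M) (d : {s // ¬ p s} → α → M) (k : {s // p s} → α)
    (l : {s // ¬ p s} → α) :
    ∏ s, glue p b d s (glue p k l s) = (∏ s, b s (k s)) * ∏ s, d s (l s) := by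
  rw [← Fintype.prod_subtype_mul_prod_subtype p]
  congr 1 <;> exact Finset.prod_congr rfl fun s _ => by simp [glue, s.2]

/-- The constant term of the product of the Laurent series with coefficients `d s`. -/
noncomputable def constantTerm {D : Type*} [Fintype D] (d : D → ℤ → ℂ) : ℂ :=
  ∑' l : D → ℤ, if ∑ s, l s = 0 then ∏ s, d s (l s) else 0

theorem constantTerm_eq_subtype {D : Type*} [Fintype D] (p : D → Prop) [DecidablePred p]
    {d : D → ℤ → ℂ} (hd : ∀ s, p s → d s = Pi.single 0 1) :
    constantTerm d = constantTerm fun s : {s // ¬ p s} => d s := by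
  classical
  set extend : ({s // ¬ p s} → ℤ) → D → ℤ := glue p 0
  have extend_injective : Function.Injective extend := fun l l' h => by
    ext s
    simpa [extend, glue, s.2] using congrFun h s
  have eq_glue : d = glue p (fun _ => Pi.single 0 1) fun s => d s := by
    ext1 s
    by_cases hs : p s <;> simp [glue, hs, hd]
  rw [constantTerm, ← extend_injective.tsum_eq, constantTerm]
  · refine tsum_congr fun l => ?_
    conv_lhs => rw [eq_glue]
    simp [extend, sum_glue, prod_glue_apply]
  · refine fun l hl => ⟨fun s => l s, funext fun s => ?_⟩
    by_cases hs : p s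
    · have factor_ne_zero : d s (l s) ≠ 0 := fun h0 =>
        hl (ite_eq_right_iff.2 fun _ => Finset.prod_eq_zero (Finset.mem_univ s) h0)
      rw [hd s hs, Pi.single_apply, ite_ne_right_iff] at factor_ne_zero
      simp [extend, glue, hs, factor_ne_zero.1]
    · simp [extend, glue, hs]

theorem constantTerm_single {D : Type*} [Fintype D] :
    constantTerm (fun _ : D => Pi.single 0 1) = 1 := by
  have isEmpty : IsEmpty {_s : D // ¬ True} := ⟨fun s => s.2 trivial⟩
  rw [constantTerm_eq_subtype (fun _ => True) fun _ _ => rfl, constantTerm,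
    (hasSum_unique _).tsum_eq]
  simp

theorem IsPairedMoment.tendsto_sum_mul_pathSum {I : Type*} {r : ℕ} {p : Fin r → Prop}
    [DecidablePred p] {i : {s // p s} → I} {M : ℕ → ({s // p s} → ℤ) → ℂ} {C : ℝ}
    (hM : IsPairedMoment i M C) (e : Bool) {d : {s // ¬ p s} → ℤ → ℂ}
    (hd : ∀ s, Summable fun k => ‖d s k‖) :
    Tendsto (fun n : ℕ => ∑ l ∈ Fintype.piFinset fun _ : {s // ¬ p s} => Finset.Ioo (-n : ℤ) n,
      (∏ s, d s (l s)) * pathSum M e l n) atTop (𝓝 (constantTerm d * pathLimit i M e)) := by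
  have limit_eq : constantTerm d * pathLimit i M e =
      ∑' l : {s // ¬ p s} → ℤ, (∏ s, d s (l s)) *
        (if ∑ s, l s = 0 then pathLimit i M e else 0) := by
    rw [constantTerm, ← tsum_mul_right]
    exact tsum_congr fun l => by split_ifs <;> simp
  have sum_eq_tsum : ∀ n : ℕ,
      ∑ l ∈ Fintype.piFinset fun _ : {s // ¬ p s} => Finset.Ioo (-n : ℤ) n,
        (∏ s, d s (l s)) * pathSum M e l n =
      ∑' l : {s // ¬ p s} → ℤ, if l ∈ Fintype.piFinset fun _ => Finset.Ioo (-n : ℤ) n then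
        (∏ s, d s (l s)) * pathSum M e l n else 0 := fun n => by
    rw [tsum_eq_sum fun l hl => if_neg hl]
    exact Finset.sum_congr rfl fun l hl => (if_pos hl).symm
  simp only [sum_eq_tsum, limit_eq]
  set C' : ℝ := ∑ _S : Setoid {s // p s}, ∑ _σ : {s // p s} → Bool, C
  have C'_nonneg : 0 ≤ C' :=
    (norm_nonneg _).trans (hM.norm_pathSum_le (e := e) (l := 0) le_rfl)
  refine tendsto_tsum_of_dominated_convergence (bound := fun l => (∏ s, ‖d s (l s)‖) * C')
    ((summable_prod_pi (fun s k => norm_nonneg (d s k)) hd).mul_right _) (fun l => ?_) ?_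
  · have eventually_mem : ∀ᶠ n : ℕ in atTop, ∀ s, l s ∈ Finset.Ioo (-n : ℤ) n := by
      refine eventually_all.2 fun s => ?_
      filter_upwards [eventually_gt_atTop (l s).natAbs] with n hn
      rw [Finset.mem_Ioo]
      lia
    refine (hM.tendsto_pathSum.const_mul _).congr' ?_
    filter_upwards [eventually_mem] with n hn
    rw [if_pos (Fintype.mem_piFinset.2 hn)]
  · filter_upwards [eventually_ge_atTop 1] with n hn l
    split_ifs
    · rw [norm_mul, norm_prod]
      gcongr
      exact hM.norm_pathSum_le hn
    · rw [norm_zero]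
      positivity

theorem trace_prod_toeplitz_glue (n : ℕ) {r : ℕ} {p : Fin r → Prop} [DecidablePred p]
    (b : {s // p s} → ℤ → ℂ) (d : {s // ¬ p s} → ℤ → ℂ) (e : Bool) :
    ((List.ofFn fun s => toeplitz n (glue p b d s)).prod * flipMatrix n e).trace =
      ∑ l ∈ Fintype.piFinset fun _ => Finset.Ioo (-n : ℤ) n, (∏ s, d s (l s)) *
        ∑ k ∈ Fintype.piFinset fun _ => Finset.Ioo (-n : ℤ) n, (∏ s, b s (k s)) *
          ∑ j ∈ Finset.range n, if IsClosedPath n e (glue p k l) j then 1 else 0 := by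
  rw [trace_prod_toeplitz, sum_piFinset_glue p]
  refine Finset.sum_congr rfl fun l _ => ?_
  rw [Finset.mul_sum]
  refine Finset.sum_congr rfl fun k _ => ?_
  rw [prod_glue_apply]
  ring

section MatrixState

variable {Ω : Type*} [MeasurableSpace Ω] {μ : Measure Ω} {r : ℕ} {p : Fin r → Prop}
  [DecidablePred p] {x : {s // p s} → ℤ → Ω → ℂ}
  (hx : ∀ k : {s // p s} → ℤ, Integrable (fun ω => ∏ s, x s (k s) ω) μ)

include hx

theorem integrable_prod_const_mul (z : ℂ) (k : {s // p s} → ℤ) :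
    Integrable (fun ω => ∏ s, z * x s (k s) ω) μ := by
  simp only [Finset.prod_mul_distrib]
  exact (hx k).const_mul _

theorem integrable_trace_prod_toeplitz (z : ℂ) (d : {s // ¬ p s} → ℤ → ℂ) (e : Bool) (n : ℕ) :
    Integrable (fun ω => ((List.ofFn fun s => toeplitz n
      (glue p (fun s k => z * x s k ω) d s)).prod * flipMatrix n e).trace) μ := by
  simp only [trace_prod_toeplitz_glue]
  exact integrable_finsetSum _ fun l _ => (integrable_finsetSum _ fun k _ =>
    (integrable_prod_const_mul hx z k).mul_const _).const_mul _

theorem matrixState_prod_toeplitz {M : ℕ → ({s // p s} → ℤ) → ℂ} {n : ℕ}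
    (hM : ∀ k, M n k = ∫ ω, ∏ s, x s (k s) ω ∂μ) (d : {s // ¬ p s} → ℤ → ℂ) (e : Bool) :
    matrixState μ (fun ω => (List.ofFn fun s => toeplitz n
        (glue p (fun s k => ((√n)⁻¹ : ℝ) * x s k ω) d s)).prod * flipMatrix n e) =
      ∑ l ∈ Fintype.piFinset fun _ : {s // ¬ p s} => Finset.Ioo (-n : ℤ) n,
        (∏ s, d s (l s)) * pathSum M e l n := by
  simp only [matrixState, trace_prod_toeplitz_glue]
  have integrable_summand := fun k => integrable_prod_const_mul hx ((√n)⁻¹ : ℝ) k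
  rw [integral_finsetSum _ fun l _ => (integrable_finsetSum _ fun k _ =>
    (integrable_summand k).mul_const _).const_mul _, Finset.mul_sum]
  refine Finset.sum_congr rfl fun l _ => ?_
  rw [integral_const_mul, integral_finsetSum _ fun k _ => (integrable_summand k).mul_const _,
    pathSum, mul_left_comm, Finset.mul_sum, Finset.smul_sum]
  congr 1
  refine Finset.sum_congr rfl fun k _ => ?_
  simp only [integral_mul_const, Finset.prod_mul_distrib, integral_const_mul, hM, Finset.prod_const,
    Finset.card_univ, Complex.real_smul, Complex.ofReal_mul, Complex.ofReal_inv,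
    Complex.ofReal_natCast, Complex.ofReal_pow, mul_assoc]

end MatrixState

theorem tendsto_matrixState_prod_toeplitz_const {Ω : ℕ → Type*} [∀ n, MeasurableSpace (Ω n)]
    {μ : ∀ n, Measure (Ω n)} [∀ n, IsProbabilityMeasure (μ n)] {r : ℕ} {d : Fin r → ℤ → ℂ}
    (hd : ∀ s, Summable fun k => ‖d s k‖) (e : Bool) :
    Tendsto (fun n : ℕ => matrixState (μ n) fun _ =>
        (List.ofFn fun s => toeplitz n (d s)).prod * flipMatrix n e) atTop
      (𝓝 (constantTerm d * if e then 0 else 1)) := by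
  have isEmpty : IsEmpty {_s : Fin r // False} := ⟨fun s => s.2⟩
  set i : {_s : Fin r // False} → Empty := isEmptyElim
  have pathLimit_eq : pathLimit i (fun _ _ => 1) e = if e then 0 else 1 := by
    cases e
    · exact pathLimit_one
    · exact pathLimit_true
  rw [constantTerm_eq_subtype (fun _ => False) fun _ => False.elim, ← pathLimit_eq]
  refine ((isPairedMoment_one i).tendsto_sum_mul_pathSum e fun s => hd s).congr fun n => Eq.symm ?_
  have := matrixState_prod_toeplitz (μ := μ n) (p := fun _ : Fin r => False) (x := isEmptyElim)
    (M := fun _ _ => 1) (n := n) (fun _ => by simp) (fun _ => by simp) (fun s => d s) e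
  simpa only [glue, dite_false] using this

section PairCorrelated

variable {I : Type*} {Ω : ℕ → Type*} [∀ n, MeasurableSpace (Ω n)] {μ : ∀ n, Measure (Ω n)}
  [∀ n, IsProbabilityMeasure (μ n)] {σx σy ρ₁ ρ₂ ρ₃ ρ₄ ρ₅ ρ₆ : I → ℝ} {c : I → ℕ → ℝ}
  {a : ∀ n, I → ℤ → Ω n → ℂ}
  (h : ∀ n, 1 ≤ n → ∀ i, PairCorrelated (μ n) (σx i) (σy i) (ρ₁ i) (ρ₂ i) (ρ₃ i) (ρ₄ i) (ρ₅ i)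
    (ρ₆ i) (c i) (a n i))
  (hind : ∀ n, 1 ≤ n → iIndepFun (fun i ω j => a n i j ω) (μ n))

include h hind

theorem isPairedMoment_mixedMoment {T : Type*} [Fintype T] (τ : T → I × Bool × Bool) :
    IsPairedMoment (fun s => (τ s).1) (fun n => mixedMoment (μ n) (a n) τ)
      (1 + ∑ s, 2 ^ Fintype.card T * c (τ s).1 (Fintype.card T)) where
  norm_le n hn := norm_mixedMoment_le (h n hn) τ
  eq_zero n hn _ _ hs := mixedMoment_eq_zero (h n hn) (hind n hn) hs
  congr n n' hn hn' _ hS _ _ hk hk' hsign :=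
    mixedMoment_congr (h n hn) (hind n hn) (h n' hn') (hind n' hn') hS hk hk' hsign

theorem tendsto_matrixState_prod_toeplitz {r : ℕ} {p : Fin r → Prop} [DecidablePred p]
    (τ : {s // p s} → I × Bool × Bool) {d : {s // ¬ p s} → ℤ → ℂ}
    (hd : ∀ s, Summable fun k => ‖d s k‖) (e : Bool) :
    Tendsto (fun n : ℕ => matrixState (μ n) fun ω => (List.ofFn fun s => toeplitz n
        (glue p (fun s k => ((√n)⁻¹ : ℝ) * inputEntry (a n) (τ s) k ω) d s)).prod *
          flipMatrix n e) atTop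
      (𝓝 (constantTerm d *
        pathLimit (fun s => (τ s).1) (fun n => mixedMoment (μ n) (a n) τ) e)) := by
  refine ((isPairedMoment_mixedMoment h hind τ).tendsto_sum_mul_pathSum e hd).congr' ?_
  filter_upwards [eventually_ge_atTop 1] with n hn
  exact (matrixState_prod_toeplitz (integrable_prod_inputEntry (h n hn) τ) (fun _ => rfl) d e).symm

end PairCorrelated

/-! ### Words in Toeplitz matrices and backward identities -/

theorem twist_single_zero (t : Bool × Bool) : twist t (Pi.single 0 1) = Pi.single 0 1 := by
  ext k
  obtain ⟨e, b⟩ := t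
  cases e <;> cases b <;> simp [twist, conjIf, negIf, Pi.single_apply, apply_ite]

theorem twist_ofReal_mul (t : Bool × Bool) (z : ℝ) (g : ℤ → ℂ) (k : ℤ) :
    twist t (fun k => z * g k) k = z * twist t g k := by
  obtain ⟨_, b⟩ := t
  cases b <;> simp [twist, conjIf]

theorem summable_norm_twist (t : Bool × Bool) {g : ℤ → ℂ} (hg : Summable fun k => ‖g k‖) :
    Summable fun k => ‖twist t g k‖ := by
  simp only [twist, norm_conjIf]
  cases t.1
  · exact hg
  · exact (Equiv.neg ℤ).summable_iff.2 hg

theorem summable_norm_single (k : ℤ) (z : ℂ) : Summable fun j => ‖(Pi.single k z : ℤ → ℂ) j‖ :=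
  summable_of_ne_finset_zero (s := {k}) fun j hj => by
    rw [Pi.single_eq_of_ne (by simpa using hj), norm_zero]

theorem toeplitz_smul (n : ℕ) (z : ℂ) (g : ℤ → ℂ) :
    z • toeplitz n g = toeplitz n fun k => z * g k := by
  ext i j
  simp [toeplitz]

theorem ite_star_toeplitz (n : ℕ) (s : Bool) (g : ℤ → ℂ) :
    (if s then star (toeplitz n g) else toeplitz n g) = toeplitz n (twist (s, s) g) := by
  cases s
  · rfl
  · ext i j
    simp [toeplitz, twist, conjIf, negIf, Matrix.star_apply]

theorem backwardIdentity_mul_apply {n : ℕ} (A : Matrix (Fin n) (Fin n) ℂ) (i j : Fin n) :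
    (backwardIdentity n * A) i j = A i.rev j := by
  rw [Matrix.mul_apply, Finset.sum_eq_single i.rev]
  · simp [backwardIdentity]
  · intro k _ hk
    have i_ne : i ≠ k.rev := fun h => hk (by rw [h, Fin.rev_rev])
    simp [backwardIdentity, i_ne]
  · simp

theorem star_backwardIdentity (n : ℕ) : star (backwardIdentity n) = backwardIdentity n := by
  ext i j
  simp [backwardIdentity, Matrix.star_apply, apply_ite, eq_comm (a := j), Fin.rev_eq_iff]

theorem flipMatrix_mul_backwardIdentity (n : ℕ) (e : Bool) :
    flipMatrix n e * backwardIdentity n = flipMatrix n (!e) := by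
  cases e
  · simp [flipMatrix]
  · ext i j
    simp only [flipMatrix, if_true, backwardIdentity_mul_apply]
    simp [backwardIdentity, Matrix.one_apply]

theorem flipMatrix_mul_toeplitz (n : ℕ) (e : Bool) (g : ℤ → ℂ) :
    flipMatrix n e * toeplitz n g = toeplitz n (twist (e, false) g) * flipMatrix n e := by
  cases e
  · simp [flipMatrix, show twist (false, false) g = g from rfl]
  · ext i j
    simp only [flipMatrix, if_true, backwardIdentity_mul_apply, mul_backwardIdentity_apply,
      toeplitz, twist, conjIf, negIf, Matrix.of_apply, Fin.val_rev, Bool.false_eq_true, if_false]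
    congr 1
    omega

theorem twist_twist (e s : Bool) (g : ℤ → ℂ) :
    twist (e, false) (twist (s, s) g) = twist (xor s e, s) g := by
  ext k
  cases e <;> cases s <;> simp [twist, conjIf, negIf]

section Word

variable {m : ℕ}

/-- The backward identity and the Toeplitz matrices with input sequences `f`, indexed by letters. -/
def letterMatrix (n : ℕ) (f : Fin m ⊕ Fin m → ℤ → ℂ) : Letter m → Matrix (Fin n) (Fin n) ℂ
  | .P => backwardIdentity n
  | .T i => toeplitz n (f (.inl i))
  | .D i => toeplitz n (f (.inr i))

/-- The letters `T i` and `D i` of a word, coded by `Sum.inl i` and `Sum.inr i`. Each comes with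
the twist that its input sequence undergoes when `star` is expanded and all letters `P` are moved to
the right; `b` is the parity of the number of letters `P` already passed. -/
def slots : Bool → List (Letter m × Bool) → List ((Fin m ⊕ Fin m) × Bool × Bool)
  | _, [] => []
  | b, (.P, _) :: w => slots (!b) w
  | b, (.T i, s) :: w => (.inl i, xor s b, s) :: slots b w
  | b, (.D i, s) :: w => (.inr i, xor s b, s) :: slots b w

theorem countP_slots (b : Bool) (w : List (Letter m × Bool)) :
    (slots b w).countP (fun u => u.1.isLeft) = w.countP fun u => u.1.isT := by
  induction w generalizing b with
  | nil => rfl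
  | cons u w ih =>
    rw [List.countP_cons, ← ih b]
    obtain ⟨_ | i | i, s⟩ := u
    · exact (ih _).trans (ih _).symm
    · exact List.countP_cons
    · exact List.countP_cons

/-- The parity of the number of letters `P`. -/
def wordFlip (w : List (Letter m × Bool)) : Bool := decide (Odd (w.countP fun u => u.1.isP))

theorem wordFlip_cons (u : Letter m × Bool) (w : List (Letter m × Bool)) :
    wordFlip (u :: w) = xor u.1.isP (wordFlip w) := by
  rw [wordFlip, wordFlip, List.countP_cons]
  cases u.1.isP <;> simp [Nat.odd_add_one, -Nat.not_odd_iff_even]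

theorem flipMatrix_mul_starMonomial (n : ℕ) (f : Fin m ⊕ Fin m → ℤ → ℂ) (b : Bool)
    (w : List (Letter m × Bool)) :
    flipMatrix n b * starMonomial (letterMatrix n f) w =
      ((slots b w).map fun u => toeplitz n (twist u.2 (f u.1))).prod *
        flipMatrix n (xor b (wordFlip w)) := by
  have cons_eq : ∀ u w, starMonomial (letterMatrix n f) (u :: w) =
      (if u.2 then star (letterMatrix n f u.1) else letterMatrix n f u.1) *
        starMonomial (letterMatrix n f) w := fun u w => List.prod_cons
  induction w generalizing b with
  | nil => simp [slots, starMonomial, wordFlip]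
  | cons u w ih =>
    obtain ⟨_ | i | i, s⟩ := u
    · simp only [cons_eq, letterMatrix, star_backwardIdentity, ite_self, ← mul_assoc,
        flipMatrix_mul_backwardIdentity, ih, slots, wordFlip_cons, Letter.isP, Bool.true_xor,
        Bool.xor_not, Bool.not_xor]
    all_goals
      simp only [cons_eq, letterMatrix, ite_star_toeplitz, ← mul_assoc, flipMatrix_mul_toeplitz,
        twist_twist]
      simp only [mul_assoc, ih, slots, List.map_cons, List.prod_cons, wordFlip_cons, Letter.isP,
        Bool.false_xor]

theorem starMonomial_letterMatrix (n : ℕ) (f : Fin m ⊕ Fin m → ℤ → ℂ)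
    (w : List (Letter m × Bool)) :
    starMonomial (letterMatrix n f) w =
      (List.ofFn fun s => toeplitz n
        (twist ((slots false w).get s).2 (f ((slots false w).get s).1))).prod *
          flipMatrix n (wordFlip w) := by
  have := flipMatrix_mul_starMonomial n f false w
  rw [Bool.false_xor] at this
  rw [← one_mul (starMonomial _ w)]
  refine this.trans ?_
  congr 2
  exact (List.ofFn_getElem_eq_map _ _).symm

theorem starMonomial_filter {ι A : Type*} [Semiring A] [StarRing A] (x : ι → A)
    (keep : ι → Bool) (w : List (ι × Bool)) :
    starMonomial x (w.filter fun u => keep u.1) =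
      starMonomial (fun i => if keep i then x i else 1) w := by
  induction w with
  | nil => rfl
  | cons u w ih =>
    simp only [starMonomial, List.map_cons, List.prod_cons] at ih ⊢
    rw [List.filter_cons]
    split_ifs <;> simp_all

end Word

section Word

variable {m : ℕ} (w : List (Letter m × Bool))

/-- Does the position `s` of `slots false w` hold a letter `T i`? -/
abbrev IsRandomSlot (s : Fin (slots false w).length) : Prop :=
  ((slots false w).get s).1.isLeft = true

/-- The number `i` of the letter `T i` at the position `s`, with its twist. -/
def randomSlot (s : {s // IsRandomSlot w s}) : Fin m × Bool × Bool :=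
  (((slots false w).get s).1.getLeft s.2, ((slots false w).get s).2)

/-- The input sequence at the position `s`, where all `T i` are replaced by the identity matrix. -/
noncomputable def deterministicSeq (d : Fin m → ℤ → ℂ) (s : Fin (slots false w).length) : ℤ → ℂ :=
  twist ((slots false w).get s).2
    (Sum.elim (fun _ => Pi.single 0 1) d ((slots false w).get s).1)

/-- The contribution of the letters `D i` to the limit of the moments of `w`. -/
noncomputable def deterministicFactor (d : Fin m → ℤ → ℂ) : ℂ := constantTerm (deterministicSeq w d)

/-- The contribution of the letters `P` and `T i` to the limit of the moments of `w`. -/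
noncomputable def randomFactor {Ω : ℕ → Type*} [∀ n, MeasurableSpace (Ω n)]
    (μ : ∀ n, Measure (Ω n)) (a : ∀ n, Fin m → ℤ → Ω n → ℂ) : ℂ :=
  pathLimit (fun s => (randomSlot w s).1) (fun n => mixedMoment (μ n) (a n) (randomSlot w))
    (wordFlip w)

variable {w}

theorem deterministicSeq_of_isRandomSlot (d : Fin m → ℤ → ℂ) {s : Fin (slots false w).length}
    (hs : IsRandomSlot w s) : deterministicSeq w d s = Pi.single 0 1 := by
  obtain ⟨i, hi⟩ := Sum.isLeft_iff.1 hs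
  rw [deterministicSeq, hi, Sum.elim_inl, twist_single_zero]

variable (w) in
theorem summable_norm_deterministicSeq {d : Fin m → ℤ → ℂ}
    (hd : ∀ i, Summable fun k => ‖d i k‖) (s : Fin (slots false w).length) :
    Summable fun k => ‖deterministicSeq w d s k‖ := by
  refine summable_norm_twist _ ?_
  cases ((slots false w).get s).1 with
  | inl i => exact summable_norm_single 0 1
  | inr i => exact hd i

theorem deterministicFactor_eq_subtype (d : Fin m → ℤ → ℂ) :
    deterministicFactor w d =
      constantTerm fun s : {s // ¬ IsRandomSlot w s} => deterministicSeq w d s :=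
  constantTerm_eq_subtype _ fun _ => deterministicSeq_of_isRandomSlot d

theorem deterministicFactor_single :
    deterministicFactor w (fun _ => Pi.single 0 1) = 1 := by
  have seq_eq : deterministicSeq w (fun _ => Pi.single 0 1) = fun _ => Pi.single 0 1 := by
    ext1 s
    rw [deterministicSeq, Sum.elim_lam_const_lam_const, twist_single_zero]
  rw [deterministicFactor, seq_eq, constantTerm_single]

theorem card_subtype_get {α : Type*} (u : List α) (f : α → Bool) :
    Fintype.card {s : Fin u.length // f (u.get s) = true} = u.countP f := by
  rw [Fintype.card_subtype, Finset.card_filter]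
  induction u with
  | nil => rfl
  | cons x u ih =>
    rw [List.countP_cons, ← ih, add_comm]
    exact Fin.sum_univ_succ _

section Limit

variable {Ω : ℕ → Type*} [∀ n, MeasurableSpace (Ω n)] {μ : ∀ n, Measure (Ω n)}
  {a : ∀ n, Fin m → ℤ → Ω n → ℂ} {d : Fin m → ℤ → ℂ}

theorem randomFactor_eq_zero
    (hodd : Odd (w.countP fun u => u.1.isP) ∨ Odd (w.countP fun u => u.1.isT)) :
    randomFactor w μ a = 0 := by
  rcases hodd with hodd | hodd
  · rw [randomFactor, wordFlip, decide_eq_true hodd, pathLimit_true]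
  · refine pathLimit_eq_zero_of_odd ?_
    rwa [card_subtype_get (slots false w) fun u => u.1.isLeft, countP_slots]

/-- The limit of the moments of the word `w`. -/
noncomputable def limitMoment (μ : ∀ n, Measure (Ω n)) (a : ∀ n, Fin m → ℤ → Ω n → ℂ)
    (d : Fin m → ℤ → ℂ) (w : List (Letter m × Bool)) : ℂ :=
  deterministicFactor w d * randomFactor w μ a

theorem limitMoment_eq_zero
    (hodd : Odd (w.countP fun u => u.1.isP) ∨ Odd (w.countP fun u => u.1.isT)) :
    limitMoment μ a d w = 0 := by
  rw [limitMoment, randomFactor_eq_zero hodd, mul_zero]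

end Limit

theorem modelMatrix_eq_letterMatrix {Ω : Type*} (n : ℕ) (a : Fin m → ℤ → Ω → ℂ)
    (d : Fin m → ℤ → ℂ) (x : Letter m) (ω : Ω) :
    modelMatrix n a d x ω =
      letterMatrix n (Sum.elim (fun i k => ((√n)⁻¹ : ℝ) * a i k ω) d) x := by
  cases x with
  | P => rfl
  | T i => exact toeplitz_smul _ _ _
  | D i => rfl

theorem starMonomial_modelMatrix {Ω : Type*} (n : ℕ) (a : Fin m → ℤ → Ω → ℂ)
    (d : Fin m → ℤ → ℂ) (ω : Ω) :
    starMonomial (fun x => modelMatrix n a d x ω) w =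
      (List.ofFn fun s => toeplitz n (glue (IsRandomSlot w)
        (fun s k => ((√n)⁻¹ : ℝ) * inputEntry a (randomSlot w s) k ω)
        (fun s => deterministicSeq w d s) s)).prod * flipMatrix n (wordFlip w) := by
  simp only [modelMatrix_eq_letterMatrix, starMonomial_letterMatrix]
  congr! 5 with s
  unfold glue
  split_ifs with hs
  · obtain ⟨i, hi⟩ := Sum.isLeft_iff.1 hs
    ext k
    simp only [hi, Sum.elim_inl, randomSlot, Sum.getLeft_inl, inputEntry, twist_ofReal_mul]
  · obtain ⟨i, hi⟩ := Sum.isRight_iff.1 (Sum.not_isLeft.1 hs)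
    simp only [deterministicSeq, hi, Sum.elim_inr]

theorem starMonomial_filter_not_isT {Ω : Type*} (n : ℕ) (a : Fin m → ℤ → Ω → ℂ)
    (d : Fin m → ℤ → ℂ) (ω : Ω) :
    starMonomial (fun x => modelMatrix n a d x ω) (w.filter fun u => !u.1.isT) =
      (List.ofFn fun s => toeplitz n (deterministicSeq w d s)).prod *
        flipMatrix n (wordFlip w) := by
  have letter_eq : ∀ x, (if !x.isT then modelMatrix n a d x ω else 1) =
      letterMatrix n (Sum.elim (fun _ => Pi.single 0 1) d) x := by
    rintro (_ | _ | _)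
    · rfl
    · exact (toeplitz_single_zero n).symm
    · rfl
  refine (starMonomial_filter (fun x => modelMatrix n a d x ω) (fun x => !x.isT) w).trans ?_
  simp only [letter_eq, starMonomial_letterMatrix, deterministicSeq]

theorem starMonomial_filter_not_isD {Ω : Type*} (n : ℕ) (a : Fin m → ℤ → Ω → ℂ)
    (d : Fin m → ℤ → ℂ) (ω : Ω) :
    starMonomial (fun x => modelMatrix n a d x ω) (w.filter fun u => !u.1.isD) =
      starMonomial (fun x => modelMatrix n a (fun _ => Pi.single 0 1) x ω) w := by
  refine (starMonomial_filter (fun x => modelMatrix n a d x ω) (fun x => !x.isD) w).trans ?_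
  congr 1
  ext1 (_ | _ | _)
  · rfl
  · rfl
  · exact (toeplitz_single_zero n).symm

section PairCorrelated

variable {Ω : ℕ → Type*} [∀ n, MeasurableSpace (Ω n)] {μ : ∀ n, Measure (Ω n)}
  [∀ n, IsProbabilityMeasure (μ n)] {σx σy ρ₁ ρ₂ ρ₃ ρ₄ ρ₅ ρ₆ : Fin m → ℝ} {c : Fin m → ℕ → ℝ}
  {a : ∀ n, Fin m → ℤ → Ω n → ℂ} {d : Fin m → ℤ → ℂ}

theorem integrable_trace_starMonomial {n : ℕ} (h : ∀ i, PairCorrelated (μ n) (σx i) (σy i) (ρ₁ i)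
    (ρ₂ i) (ρ₃ i) (ρ₄ i) (ρ₅ i) (ρ₆ i) (c i) (a n i)) (w : List (Letter m × Bool)) :
    Integrable (fun ω => (starMonomial (fun x => modelMatrix n (a n) d x ω) w).trace) (μ n) := by
  simp only [starMonomial_modelMatrix]
  exact integrable_trace_prod_toeplitz (integrable_prod_inputEntry h (randomSlot w)) _ _ _ n

variable
  (h : ∀ n, 1 ≤ n → ∀ i, PairCorrelated (μ n) (σx i) (σy i) (ρ₁ i) (ρ₂ i) (ρ₃ i) (ρ₄ i) (ρ₅ i)
    (ρ₆ i) (c i) (a n i))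
  (hind : ∀ n, 1 ≤ n → iIndepFun (fun i ω j => a n i j ω) (μ n))
  (hd : ∀ i, Summable fun k => ‖d i k‖) (w : List (Letter m × Bool))

include h hind hd

theorem tendsto_matrixState_starMonomial :
    Tendsto (fun n => matrixState (μ n) fun ω =>
      starMonomial (fun x => modelMatrix n (a n) d x ω) w) atTop
      (𝓝 (limitMoment μ a d w)) := by
  simp only [starMonomial_modelMatrix, limitMoment, deterministicFactor_eq_subtype]
  exact tendsto_matrixState_prod_toeplitz (d := fun s => deterministicSeq w d s) h hind
    (randomSlot w) (fun s => summable_norm_deterministicSeq w hd s.1) (wordFlip w)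

theorem limitMoment_filter_not_isT :
    limitMoment μ a d (w.filter fun u => !u.1.isT) =
      deterministicFactor w d * if wordFlip w then 0 else 1 := by
  refine tendsto_nhds_unique (tendsto_matrixState_starMonomial h hind hd _) ?_
  simp only [starMonomial_filter_not_isT]
  exact tendsto_matrixState_prod_toeplitz_const (summable_norm_deterministicSeq w hd) (wordFlip w)

theorem limitMoment_filter_not_isD :
    limitMoment μ a d (w.filter fun u => !u.1.isD) = randomFactor w μ a := by
  refine tendsto_nhds_unique (tendsto_matrixState_starMonomial h hind hd _) ?_
  simp only [starMonomial_filter_not_isD]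
  have tendsto_limit := tendsto_matrixState_starMonomial (d := fun _ => Pi.single 0 1) h hind
    (fun _ => summable_norm_single 0 1) w
  rwa [limitMoment, deterministicFactor_single, one_mul] at tendsto_limit

theorem limitMoment_eq_mul :
    limitMoment μ a d w = limitMoment μ a d (w.filter fun u => !u.1.isT) *
      limitMoment μ a d (w.filter fun u => !u.1.isD) := by
  rw [limitMoment_filter_not_isT h hind hd, limitMoment_filter_not_isD h hind hd, limitMoment]
  by_cases hodd : Odd (w.countP fun u => u.1.isP)
  · rw [randomFactor_eq_zero (.inl hodd), mul_zero, mul_zero]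
  · simp [wordFlip, hodd]

end PairCorrelated

end Word

/-! ### The `*`-algebra of noncommutative `*`-polynomials -/

/-- The algebra of noncommutative polynomials in the variables `x i` and their adjoints; the
generator `(i, true)` is the adjoint of `x i`. -/
def StarPolynomial (ι : Type*) := MonoidAlgebra ℂ (FreeMonoid (ι × Bool))

namespace StarPolynomial

variable {ι A : Type*} [Ring A] [Algebra ℂ A]

noncomputable instance : Ring (StarPolynomial ι) :=
  inferInstanceAs (Ring (MonoidAlgebra ℂ (FreeMonoid (ι × Bool))))

noncomputable instance : Algebra ℂ (StarPolynomial ι) :=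
  inferInstanceAs (Algebra ℂ (MonoidAlgebra ℂ (FreeMonoid (ι × Bool))))

/-- The monomial with the given letters. -/
noncomputable def monomial : FreeMonoid (ι × Bool) →* StarPolynomial ι :=
  MonoidAlgebra.of ℂ (FreeMonoid (ι × Bool))

theorem induction_on {motive : StarPolynomial ι → Prop} (f : StarPolynomial ι)
    (mono : ∀ w, motive (monomial w)) (add : ∀ f g, motive f → motive g → motive (f + g))
    (smul : ∀ (r : ℂ) f, motive f → motive (r • f)) : motive f :=
  MonoidAlgebra.induction_on (R := ℂ) (M := FreeMonoid (ι × Bool)) f mono add smul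

/-- The algebra homomorphism with the given values at the generators. -/
noncomputable def lift (v : ι × Bool → A) : StarPolynomial ι →ₐ[ℂ] A :=
  MonoidAlgebra.lift ℂ A (FreeMonoid (ι × Bool)) (FreeMonoid.lift v)

theorem lift_monomial (v : ι × Bool → A) (w : FreeMonoid (ι × Bool)) :
    lift v (monomial w) = FreeMonoid.lift v w :=
  MonoidAlgebra.lift_of _ _

/-- Complex conjugation of the coefficients. -/
noncomputable def conjCoeff : StarPolynomial ι →+* StarPolynomial ι :=
  MonoidAlgebra.mapRingHom (FreeMonoid (ι × Bool)) (starRingEnd ℂ)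

theorem conjCoeff_monomial (w : FreeMonoid (ι × Bool)) : conjCoeff (monomial w) = monomial w :=
  (MonoidAlgebra.mapRingHom_single _ _ _).trans (congrArg _ (map_one _))

theorem conjCoeff_smul (r : ℂ) (f : StarPolynomial ι) :
    conjCoeff (r • f) = star r • conjCoeff f := by
  rw [Algebra.smul_def, map_mul, Algebra.smul_def]
  congr 1
  exact MonoidAlgebra.mapRingHom_single (starRingEnd ℂ) 1 r

/-- The `*`-operation, as a ring homomorphism into the opposite ring. -/
noncomputable def opStar : StarPolynomial ι →+* (StarPolynomial ι)ᵐᵒᵖ :=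
  (lift fun p : ι × Bool => .op (monomial (.of (p.1, !p.2)))).toRingHom.comp conjCoeff

theorem opStar_apply (f : StarPolynomial ι) :
    opStar f = lift (fun p : ι × Bool => .op (monomial (.of (p.1, !p.2)))) (conjCoeff f) :=
  rfl

theorem opStar_smul (r : ℂ) (f : StarPolynomial ι) : opStar (r • f) = star r • opStar f := by
  rw [opStar_apply, conjCoeff_smul, map_smul, opStar_apply]

theorem opStar_monomial_of (p : ι × Bool) :
    opStar (monomial (.of p)) = .op (monomial (.of (p.1, !p.2))) := by
  rw [opStar_apply, conjCoeff_monomial, lift_monomial, FreeMonoid.lift_eval_of]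

noncomputable instance : StarRing (StarPolynomial ι) where
  star f := (opStar f).unop
  star_mul f g := by simp only [map_mul, MulOpposite.unop_mul]
  star_add f g := by simp only [map_add, MulOpposite.unop_add]
  star_involutive f := by
    induction f using induction_on with
    | mono w =>
      induction w using FreeMonoid.inductionOn' with
      | one => simp only [map_one, MulOpposite.unop_one]
      | of_mul p w ih =>
        simp only [map_mul, MulOpposite.unop_mul, ih, opStar_monomial_of, MulOpposite.unop_op,
          Bool.not_not]
    | add f g hf hg => simp only [map_add, MulOpposite.unop_add, hf, hg]
    | smul r f hf => simp only [opStar_smul, MulOpposite.unop_smul, hf, star_star]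

instance : StarModule ℂ (StarPolynomial ι) where
  star_smul r f := congrArg MulOpposite.unop (opStar_smul r f)

theorem star_monomial_of (p : ι × Bool) :
    star (monomial (.of p)) = monomial (.of (p.1, !p.2)) :=
  congrArg MulOpposite.unop (opStar_monomial_of p)

/-- The variable `x i`. -/
noncomputable def X (i : ι) : StarPolynomial ι := monomial (.of (i, false))

theorem ite_star_X (p : ι × Bool) :
    (if p.2 then star (X p.1) else X p.1) = monomial (.of p) := by
  obtain ⟨i, _ | _⟩ := p
  · rfl
  · exact star_monomial_of (i, false)

theorem starMonomial_X (w : List (ι × Bool)) :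
    starMonomial (X : ι → StarPolynomial ι) w = monomial (.ofList w) := by
  simp only [starMonomial, ite_star_X]
  induction w with
  | nil => exact (map_one _).symm
  | cons p w ih => rw [List.map_cons, List.prod_cons, ih, ← map_mul, FreeMonoid.ofList_cons]

/-- Evaluation of a noncommutative `*`-polynomial. -/
noncomputable def eval [Star A] (x : ι → A) : StarPolynomial ι →ₐ[ℂ] A :=
  lift fun p => if p.2 then star (x p.1) else x p.1

theorem eval_monomial [Star A] (x : ι → A) (w : FreeMonoid (ι × Bool)) :
    eval x (monomial w) = starMonomial x w.toList :=
  (lift_monomial _ w).trans (FreeMonoid.lift_apply _ w)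

theorem eval_star {A : Type*} [Ring A] [Algebra ℂ A] [StarRing A] [StarModule ℂ A] (x : ι → A)
    (f : StarPolynomial ι) : eval x (star f) = star (eval x f) := by
  induction f using induction_on with
  | mono w =>
    induction w using FreeMonoid.inductionOn' with
    | one => simp only [map_one, star_one]
    | of_mul p w ih =>
      simp only [map_mul, star_mul, ih, star_monomial_of]
      simp only [eval, lift_monomial, FreeMonoid.lift_eval_of]
      cases p.2 <;> simp
  | add f g hf hg => simp only [star_add, map_add, hf, hg]
  | smul r f hf => simp only [star_smul, map_smul, hf]

/-- The linear functional with the given values at the monomials. -/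
noncomputable def functional (L : List (ι × Bool) → ℂ) : StarPolynomial ι →ₗ[ℂ] ℂ where
  toFun f := Finsupp.linearCombination ℂ (fun w : FreeMonoid (ι × Bool) => L w.toList)
    (MonoidAlgebra.coeff f)
  map_add' f g := map_add (Finsupp.linearCombination ℂ _) (MonoidAlgebra.coeff f)
    (MonoidAlgebra.coeff g)
  map_smul' r f := map_smul (Finsupp.linearCombination ℂ _) r (MonoidAlgebra.coeff f)

theorem functional_monomial (L : List (ι × Bool) → ℂ) (w : FreeMonoid (ι × Bool)) :
    functional L (monomial w) = L w.toList :=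
  (Finsupp.linearCombination_single ℂ 1 w).trans (one_smul _ _)

end StarPolynomial

/-! ### The limiting `*`-probability space -/

theorem matrixState_one {Ω : Type*} [MeasurableSpace Ω] (μ : Measure Ω) [IsProbabilityMeasure μ]
    {n : ℕ} (hn : n ≠ 0) : matrixState μ (fun _ => (1 : Matrix (Fin n) (Fin n) ℂ)) = 1 := by
  simp [matrixState, hn]

theorem matrixState_mul_star_nonneg {Ω : Type*} [MeasurableSpace Ω] (μ : Measure Ω) {n : ℕ}
    (B : Ω → Matrix (Fin n) (Fin n) ℂ) :
    0 ≤ (matrixState μ fun ω => B ω * star (B ω)).re ∧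
      (matrixState μ fun ω => B ω * star (B ω)).im = 0 := by
  have trace_eq : ∀ ω, (B ω * star (B ω)).trace = ((∑ i, ∑ j, ‖B ω i j‖ ^ 2 : ℝ) : ℂ) := by
    simp [Matrix.trace, Matrix.mul_apply, Complex.mul_conj']
  have matrixState_eq : matrixState μ (fun ω => B ω * star (B ω)) =
      (((n : ℝ)⁻¹ * ∫ ω, ∑ i, ∑ j, ‖B ω i j‖ ^ 2 ∂μ : ℝ) : ℂ) := by
    simp only [matrixState, trace_eq, integral_complex_ofReal, Complex.ofReal_mul,
      Complex.ofReal_inv, Complex.ofReal_natCast]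
  rw [matrixState_eq, Complex.ofReal_re, Complex.ofReal_im]
  exact ⟨mul_nonneg (by positivity) (integral_nonneg fun ω => by positivity), rfl⟩

theorem integrable_trace_eval {ι Ω : Type*} [MeasurableSpace Ω] {μ : Measure Ω} {n : ℕ}
    {A : ι → Ω → Matrix (Fin n) (Fin n) ℂ}
    (hA : ∀ w, Integrable (fun ω => (starMonomial (fun i => A i ω) w).trace) μ)
    (f : StarPolynomial ι) :
    Integrable (fun ω => (StarPolynomial.eval (fun i => A i ω) f).trace) μ := by
  induction f using StarPolynomial.induction_on with
  | mono w => simpa only [StarPolynomial.eval_monomial] using hA _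
  | add f g hf hg =>
    simp only [map_add, Matrix.trace_add]
    exact hf.add hg
  | smul r f hf =>
    simp only [map_smul, Matrix.trace_smul]
    exact hf.smul r

section Limit

variable {Ω : ℕ → Type*} [∀ n, MeasurableSpace (Ω n)] {μ : ∀ n, Measure (Ω n)}
  {ι : Type} {A : ∀ n, ι → Ω n → Matrix (Fin n) (Fin n) ℂ} {L : List (ι × Bool) → ℂ}
  (hA : ∀ n, 1 ≤ n →
    ∀ w, Integrable (fun ω => (starMonomial (fun i => A n i ω) w).trace) (μ n))
  (hL : ∀ w, Tendsto (fun n => matrixState (μ n) fun ω => starMonomial (fun i => A n i ω) w) atTop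
    (𝓝 (L w)))

include hA hL

theorem tendsto_matrixState_eval (f : StarPolynomial ι) :
    Tendsto (fun n => matrixState (μ n) fun ω => StarPolynomial.eval (fun i => A n i ω) f) atTop
      (𝓝 (StarPolynomial.functional L f)) := by
  induction f using StarPolynomial.induction_on with
  | mono w =>
    simpa only [StarPolynomial.eval_monomial, StarPolynomial.functional_monomial] using hL w.toList
  | add f g hf hg =>
    rw [map_add]
    refine (hf.add hg).congr' ?_
    filter_upwards [eventually_ge_atTop 1] with n hn
    simp only [matrixState, map_add, Matrix.trace_add]
    rw [integral_add (integrable_trace_eval (hA n hn) f) (integrable_trace_eval (hA n hn) g),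
      mul_add]
  | smul r f hf =>
    rw [map_smul]
    refine (hf.const_smul r).congr fun n => ?_
    simp only [matrixState, map_smul, Matrix.trace_smul]
    rw [integral_smul, smul_eq_mul, smul_eq_mul, mul_left_comm]

theorem exists_starProbabilitySpace [∀ n, IsProbabilityMeasure (μ n)] :
    ∃ (S : StarProbabilitySpace) (x : ι → S.carrier), ∀ w, S.φ (starMonomial x w) = L w := by
  refine ⟨
    { carrier := StarPolynomial ι
      φ := StarPolynomial.functional L
      φ_one := ?_
      φ_nonneg := fun f => ?_ }, StarPolynomial.X, fun w => ?_⟩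
  · refine tendsto_nhds_unique (tendsto_matrixState_eval hA hL 1) (tendsto_const_nhds.congr' ?_)
    filter_upwards [eventually_ne_atTop 0] with n hn
    simp only [map_one, matrixState_one _ hn]
  · have tendsto_limit := tendsto_matrixState_eval hA hL (f * star f)
    simp only [map_mul, StarPolynomial.eval_star] at tendsto_limit
    have nonneg := fun n => matrixState_mul_star_nonneg (μ n)
      fun ω => StarPolynomial.eval (fun i => A n i ω) f
    exact ⟨ge_of_tendsto' ((Complex.continuous_re.tendsto _).comp tendsto_limit)
        fun n => (nonneg n).1,
      tendsto_nhds_unique ((Complex.continuous_im.tendsto _).comp tendsto_limit)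
        (tendsto_const_nhds.congr fun n => (nonneg n).2.symm)⟩
  · exact (congrArg _ (StarPolynomial.starMonomial_X w)).trans
      (StarPolynomial.functional_monomial L _)

end Limit

theorem theorem2p1_general {m : ℕ} {Ω : ℕ → Type*} [∀ n, MeasurableSpace (Ω n)]
    {μ : ∀ n, Measure (Ω n)} [∀ n, IsProbabilityMeasure (μ n)]
    {σx σy ρ₁ ρ₂ ρ₃ ρ₄ ρ₅ ρ₆ : Fin m → ℝ} {c : Fin m → ℕ → ℝ} {a : ∀ n, Fin m → ℤ → Ω n → ℂ}
    (ha : ∀ n, 1 ≤ n → ∀ i, PairCorrelated (μ n) (σx i) (σy i) (ρ₁ i) (ρ₂ i) (ρ₃ i) (ρ₄ i) (ρ₅ i)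
      (ρ₆ i) (c i) (a n i))
    (ha_indep : ∀ n, 1 ≤ n → iIndepFun (fun i ω j => a n i j ω) (μ n))
    {d : Fin m → ℤ → ℂ} (hd : ∀ i, Summable fun k => ‖d i k‖) :
    ∃ (S : StarProbabilitySpace) (x : Letter m → S.carrier),
      ConvergesInStarDistribution μ (fun n => modelMatrix n (a n) d) S x ∧
      (∀ w : List (Letter m × Bool),
        S.φ (starMonomial x w) =
          S.φ (starMonomial x (w.filter fun p => !p.1.isT)) *
          S.φ (starMonomial x (w.filter fun p => !p.1.isD))) ∧
      (∀ w : List (Letter m × Bool),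
        Odd (w.countP fun p => p.1.isP) ∨ Odd (w.countP fun p => p.1.isT) →
          S.φ (starMonomial x w) = 0) := by
  have integrable := fun n hn => integrable_trace_starMonomial (d := d) (ha n hn)
  have tendsto_limitMoment := tendsto_matrixState_starMonomial ha ha_indep hd
  obtain ⟨S, x, moment_eq⟩ := exists_starProbabilitySpace integrable tendsto_limitMoment
  refine ⟨S, x, fun w => ⟨fun n hn => integrable n hn w, ?_⟩, fun w => ?_, fun w hodd => ?_⟩
  · exact moment_eq w ▸ tendsto_limitMoment w
  · simpa only [moment_eq] using limitMoment_eq_mul ha ha_indep hd w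
  · exact (moment_eq w).trans (limitMoment_eq_zero hodd)

theorem theorem2p1 {m : ℕ} {Ω₀ Ω : ℕ → Type*}
    [∀ n, MeasurableSpace (Ω₀ n)] [∀ n, MeasurableSpace (Ω n)]
    (μ₀ : ∀ n, Measure (Ω₀ n)) [∀ n, IsProbabilityMeasure (μ₀ n)]
    (μ : ∀ n, Measure (Ω n)) [∀ n, IsProbabilityMeasure (μ n)]
    (σx σy ρ₁ ρ₂ ρ₃ ρ₄ ρ₅ ρ₆ : ℝ) (c : ℕ → ℝ)
    -- the input sequence of `T_n`
    (a₀ : ∀ n, ℤ → Ω₀ n → ℂ)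
    (ha₀ : ∀ n, 1 ≤ n → PairCorrelated (μ₀ n) σx σy ρ₁ ρ₂ ρ₃ ρ₄ ρ₅ ρ₆ c (a₀ n))
    -- its `m` independent copies
    (a : ∀ n, Fin m → ℤ → Ω n → ℂ)
    (ha_meas : ∀ n, 1 ≤ n → ∀ i j, Measurable (a n i j))
    (ha_copy : ∀ n, 1 ≤ n → ∀ i,
      IdentDistrib (fun ω j => a n i j ω) (fun ω j => a₀ n j ω) (μ n) (μ₀ n))
    (ha_indep : ∀ n, 1 ≤ n → iIndepFun (fun i ω j => a n i j ω) (μ n))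
    -- the deterministic input sequences
    (d : Fin m → ℤ → ℂ) (hd : ∀ i, Summable fun k => ‖d i k‖) :
    ∃ (S : StarProbabilitySpace) (x : Letter m → S.carrier),
      ConvergesInStarDistribution μ (fun n => modelMatrix n (a n) d) S x ∧
      (∀ w : List (Letter m × Bool),
        S.φ (starMonomial x w) =
          S.φ (starMonomial x (w.filter fun p => !p.1.isT)) *
          S.φ (starMonomial x (w.filter fun p => !p.1.isD))) ∧
      (∀ w : List (Letter m × Bool),
        Odd (w.countP fun p => p.1.isP) ∨ Odd (w.countP fun p => p.1.isT) →
          S.φ (starMonomial x w) = 0) := by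
  exact theorem2p1_general
    (fun n hn i => (ha₀ n hn).of_identDistrib (ha_meas n hn i) (ha_copy n hn i)) ha_indep hd
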